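/- Let $\alpha>0$, $a=(1-\sqrt\alpha)^2$, $b=(1+\sqrt\alpha)^2$, and let $$\mu_\alpha(\mathrm dx)=\frac{\sqrt{(b-x)(x-a)}}{2\pi x}\,\mathbf 1_{(a,b)}(x)\,\mathrm dx+\mathbf 1_{\alpha<1}(1-\alpha)\,\delta_0(\mathrm dx)$$ be the Marchenko–Pastur law. For $c>0$ let $A_n$ be an $n\times m$ matrix with i.i.d. Bernoulli entries of parameter $c/n$ (for $n\ge c$), where $m=m(n)$ satisfies $m/n\to\alpha$. Let $\mu_{\alpha,c}$ be the limiting spectral law of $\frac1c A_nA_n^T$, that is, the probability law on $\mathbf R$, depending only on $\alpha$ and $c$, such that for every such sequence $m(n)$ the empirical spectral measure $\frac1n\sum_{\lambda}\delta_\lambda$ (sum over the eigenvalues of $\frac1c A_nA_n^T$ with multiplicity) converges weakly to $\mu_{\alpha,c}$ in probability as $n\to\infty$. This law exists, is unique, and has finite moments of all orders. Write $M_k(\nu)=\int x^k\,\nu(\mathrm dx)$ for the $k$-th moment of a (signed) measure $\nu$. There exists a finite signed measure $\mu_\alpha^{(1)}$ on $\mathbf R$ such that for every integer $k\ge1$,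 as $c\to+\infty$, $$M_k(\mu_{\alpha,c})=M_k\Big(\mu_\alpha+\frac1c\,\mu_\alpha^{(1)}\Big)+o\Big(\frac1c\Big).$$ Moreover, $\mu_\alpha^{(1)}$ has total mass zero and is absolutely continuous with respect to Lebesgue measure, with the integrable density $$\frac{x^2-2x(\alpha+1)+(\alpha^2+1)}{2\alpha\pi\sqrt{(b-x)(x-a)}}\,\mathbf 1_{(a,b)}(x).$$ -/

import Mathlib

open MeasureTheory ProbabilityTheory Filter Topology Set
open scoped ENNReal BoundedContinuousFunction MeasureTheory.VectorMeasure

/-! ### The Marchenko-Pastur law and its first-order perturbation -/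

/-- Left edge `a = (1 - √α)²` of the Marchenko-Pastur bulk. -/
noncomputable def mpLeft (α : ℝ) : ℝ := (1 - √α) ^ 2

/-- Right edge `b = (1 + √α)²` of the Marchenko-Pastur bulk. -/
noncomputable def mpRight (α : ℝ) : ℝ := (1 + √α) ^ 2

/-- The Marchenko-Pastur density `√((b - x)(x - a)) / (2πx)`; it is used on `(a, b)` only. -/
noncomputable def mpDensity (α x : ℝ) : ℝ :=
  √((mpRight α - x) * (x - mpLeft α)) / (2 * Real.pi * x)

/-- The Marchenko-Pastur law `μ_α`. The mass at `0` is `1 - α` if `α < 1`, and `0` otherwise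
(`ENNReal.ofReal` of a non-positive number is `0`). -/
noncomputable def marchenkoPastur (α : ℝ) : Measure ℝ :=
  (volume.restrict (Ioo (mpLeft α) (mpRight α))).withDensity
      (fun x => ENNReal.ofReal (mpDensity α x))
    + ENNReal.ofReal (1 - α) • Measure.dirac 0

theorem integrableOn_mpDensity (α : ℝ) :
    IntegrableOn (mpDensity α) (Ioo (mpLeft α) (mpRight α)) := by
  have ha : 0 ≤ mpLeft α := by unfold mpLeft; positivity
  have hb : 0 < mpRight α := by
    have := Real.sqrt_nonneg α
    unfold mpRight; positivity
  have h1 : IntegrableOn (fun x : ℝ => √(mpRight α) * x ^ (-(1 / 2) : ℝ))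
      (Ioo (mpLeft α) (mpRight α)) := by
    have h0 : IntegrableOn (fun x : ℝ => x ^ (-(1 / 2) : ℝ)) (Ioo 0 (mpRight α)) :=
      (intervalIntegral.integrableOn_Ioo_rpow_iff hb).2 (by norm_num)
    exact (h0.mono_set (Ioo_subset_Ioo_left ha)).const_mul _
  refine Integrable.mono' h1 ?_ ?_
  · have hm : Measurable (mpDensity α) := by unfold mpDensity; fun_prop
    exact hm.aestronglyMeasurable
  · refine (ae_restrict_iff' measurableSet_Ioo).2 (ae_of_all _ fun x hx => ?_)
    have hx0 : 0 < x := lt_of_le_of_lt ha hx.1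
    have hpi : 1 ≤ 2 * Real.pi := by linarith [Real.pi_gt_three]
    have e1 : √((mpRight α - x) * (x - mpLeft α)) ≤ √(mpRight α) * √x := by
      rw [← Real.sqrt_mul hb.le]
      apply Real.sqrt_le_sqrt
      have := hx.1
      have := hx.2
      exact mul_le_mul (by linarith) (by linarith) (by linarith) hb.le
    have e2 : x ^ (-(1 / 2) : ℝ) = √x / x := by
      rw [Real.rpow_neg hx0.le, ← Real.sqrt_eq_rpow, Real.sqrt_div_self', one_div]
    unfold mpDensity
    rw [Real.norm_of_nonneg (by positivity), e2, ← mul_div_assoc]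
    apply div_le_div₀ (by positivity) e1 hx0
    nlinarith

instance isFiniteMeasure_marchenkoPastur (α : ℝ) : IsFiniteMeasure (marchenkoPastur α) := by
  have h1 := isFiniteMeasure_withDensity_ofReal (integrableOn_mpDensity α).2
  have h2 : IsFiniteMeasure (ENNReal.ofReal (1 - α) • Measure.dirac (0 : ℝ)) :=
    Measure.smul_finite _ ENNReal.ofReal_ne_top
  unfold marchenkoPastur
  infer_instance

/-- The density of the first-order perturbation: on `(a, b)` it is
`(x² - 2x(α + 1) + α² + 1) / (2απ √((b - x)(x - a)))`, and it vanishes elsewhere. -/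
noncomputable def perturbationDensity (α : ℝ) : ℝ → ℝ :=
  (Ioo (mpLeft α) (mpRight α)).indicator fun x =>
    (x ^ 2 - 2 * x * (α + 1) + (α ^ 2 + 1)) /
      (2 * α * Real.pi * √((mpRight α - x) * (x - mpLeft α)))

/-- The `k`-th moment `∫ xᵏ ds(x)` of a signed measure `s`. -/
noncomputable def signedMoment (k : ℕ) (s : SignedMeasure ℝ) : ℝ :=
  ∫ᵛ x, x ^ k ∂<•s

/-! ### Sparse Bernoulli Wishart matrices and their limiting spectral law -/

/-- The law of an `n × m` array of independent Bernoulli variables with parameter `c / n`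
(clipped to `[0, 1]`, which matters only for the finitely many `n < c`). -/
noncomputable def bernoulliArrayLaw (c : ℝ) (n m : ℕ) : Measure (Fin n × Fin m → Bool) :=
  Measure.pi fun _ => bernoulliMeasure true false (projIcc (0 : ℝ) 1 zero_le_one (c / n))

/-- The `n × m` matrix with `0`-`1` entries given by an array of Booleans. -/
def zeroOneMatrix {n m : ℕ} (ω : Fin n × Fin m → Bool) : Matrix (Fin n) (Fin m) ℝ :=
  Matrix.of fun i j => if ω (i, j) then 1 else 0

/-- The Wishart matrix `c⁻¹ A Aᵀ`. -/
noncomputable def wishart (c : ℝ) {n m : ℕ} (A : Matrix (Fin n) (Fin m) ℝ) :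
    Matrix (Fin n) (Fin n) ℝ :=
  c⁻¹ • (A * A.transpose)

theorem wishart_isHermitian (c : ℝ) {n m : ℕ} (A : Matrix (Fin n) (Fin m) ℝ) :
    (wishart c A).IsHermitian := by
  rw [Matrix.IsHermitian, Matrix.conjTranspose_eq_transpose_of_trivial, wishart,
    Matrix.transpose_smul, Matrix.transpose_mul, Matrix.transpose_transpose]

/-- The empirical spectral measure `(1/n) ∑ δ_λ`, the sum being over the eigenvalues with
multiplicity, of a symmetric `n × n` matrix. -/
noncomputable def empiricalSpectralMeasure {n : ℕ} {W : Matrix (Fin n) (Fin n) ℝ}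
    (hW : W.IsHermitian) : Measure ℝ :=
  (n : ℝ≥0∞)⁻¹ • ∑ i, Measure.dirac (hW.eigenvalues i)

/-- `μ` is the limiting spectral law of the Wishart matrices `c⁻¹ A Aᵀ`, where `A` is `n × m` with
independent Bernoulli entries of parameter `c / n`: it is a probability law and, whenever
`m / n → α`, the empirical spectral measure converges weakly to `μ` in probability. -/
def IsLimitingSpectralLaw (α c : ℝ) (μ : Measure ℝ) : Prop :=
  IsProbabilityMeasure μ ∧
  ∀ m : ℕ → ℕ, Tendsto (fun n => (m n : ℝ) / n) atTop (𝓝 α) →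
    ∀ f : ℝ →ᵇ ℝ, ∀ ε > 0,
      Tendsto
        (fun n => bernoulliArrayLaw c n (m n)
          {ω | ε < |(∫ x, f x ∂(empiricalSpectralMeasure
                (wishart_isHermitian c (zeroOneMatrix ω)))) - (∫ x, f x ∂μ)|})
        atTop (𝓝 0)

open Classical in
/-- The limiting spectral law `μ_{α,c}`. (The value `0` is a default, used only if there is no
limiting law.) -/
noncomputable def limitingSpectralLaw (α c : ℝ) : Measure ℝ :=
  if h : ∃ μ : Measure ℝ, IsLimitingSpectralLaw α c μ then h.choose else 0

/-! The `k`-th moment of the empirical spectral measure is `c⁻ᵏ / n` times the number of closed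
walks of length `2k` from the rows in the random bipartite graph of `A`. In expectation, reveal
edges along the walk: an edge already seen has weight `1`, a new one has weight `p`, about `c / n`.
Almost all end points are unvisited, so the new edges weigh about `αc` in total at a row and `c` at
a column, and the expectation tends to the deterministic recursion `growingWalks`
(`sparseWalks_sub_growingWalks_le`). Boundedly many edges given in advance do not change this limit.
Hence two walks decouple and the variance vanishes (`tendsto_integral_walkMean`). The limiting
moments grow at most factorially (`growingWalks_closed_le`), so they determine a law, and the method
of moments yields its existence and the weak convergence in probability.

For the expansion, note that a walk growing from no edges explores a tree. Conjugating by `√c` to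
the power of the depth gives weight `1` to a step to the parent, `α` or `1` to a new child, and `ε =
1/c` to a known child (`growingWalks_mul_pow_depth`). The moment is thus a polynomial in `ε`. Its
value at `0` counts the walks that never descend to a known child (`treeWalks`); its derivative at
`0` counts those that do so exactly once (`onceRepeatedWalks`).

Both counts have closed forms in the coefficients `mpCoeff` of powers of `F(s) = (1 + s)(1 + α/s)`:
for the moment of order `k + 1` they are `α([s⁰] - α[s²])Fᵏ` and `α[s²]Fᵏ⁺¹`. On `s = √α exp(iθ)`,
`F` equals `1 + α + 2√α cos θ`, which parametrizes the bulk, and its coefficients are cosine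
integrals. In the variable `θ` the Marchenko-Pastur bulk is `2α sin²θ / (πx) dθ` and the
perturbation is `cos 2θ / π dθ`, so the moments agree. -/

/-! ### The method of moments -/

/-- Factorial growth of the even moments gives exponential moments. -/
theorem integrable_exp_of_moment_le {μ : Measure ℝ} [IsFiniteMeasure μ] {C A t : ℝ}
    (hint : ∀ k : ℕ, Integrable (fun x : ℝ => x ^ k) μ)
    (hle : ∀ k : ℕ, ∫ x, x ^ (2 * k) ∂μ ≤ C * A ^ (2 * k) * (2 * k).factorial)
    (ht : |t * A| < 1) : Integrable (fun x : ℝ => Real.exp (t * x)) μ := by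
  have hterm : ∀ k : ℕ, ∫⁻ x, ENNReal.ofReal ((t * x) ^ (2 * k) / (2 * k).factorial) ∂μ
      ≤ ENNReal.ofReal (C * ((t * A) ^ 2) ^ k) := by
    intro k
    have hi : Integrable (fun x : ℝ => (t * x) ^ (2 * k) / (2 * k).factorial) μ := by
      simp_rw [mul_pow]
      exact ((hint (2 * k)).const_mul _).div_const _
    rw [← ofReal_integral_eq_lintegral_ofReal hi
      (ae_of_all _ fun x => by
        have : 0 ≤ (t * x) ^ (2 * k) := by rw [pow_mul]; positivity
        simp only [Pi.zero_apply]; positivity)]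
    apply ENNReal.ofReal_le_ofReal
    simp_rw [mul_pow, integral_div, integral_const_mul]
    have hf : (0 : ℝ) < (2 * k).factorial := by positivity
    rw [div_le_iff₀ hf]
    have h2 : 0 ≤ t ^ (2 * k) := by rw [pow_mul]; positivity
    calc t ^ (2 * k) * ∫ x, x ^ (2 * k) ∂μ
        ≤ t ^ (2 * k) * (C * A ^ (2 * k) * (2 * k).factorial) := by gcongr; exact hle k
      _ = _ := by ring
  -- The series of `cosh` involves even moments only and is dominated by a geometric series of ratio
  -- `(tA)²`; the bound `exp y ≤ 2 cosh y` then gives the claim.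
  have hcosh : ∫⁻ x, ENNReal.ofReal (Real.cosh (t * x)) ∂μ < ∞ := by
    have h1 : ∀ x : ℝ, ENNReal.ofReal (Real.cosh (t * x))
        = ∑' k : ℕ, ENNReal.ofReal ((t * x) ^ (2 * k) / (2 * k).factorial) := by
      intro x
      have hs := Real.hasSum_cosh (t * x)
      rw [← hs.tsum_eq, ENNReal.ofReal_tsum_of_nonneg _ hs.summable]
      intro k
      have : 0 ≤ (t * x) ^ (2 * k) := by rw [pow_mul]; positivity
      positivity
    simp_rw [h1]
    rw [lintegral_tsum fun k => by fun_prop]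
    refine (ENNReal.tsum_le_tsum hterm).trans_lt ?_
    have hC : 0 ≤ C := by
      have h0 := hle 0
      simp only [mul_zero, pow_zero, integral_const, smul_eq_mul, mul_one, Nat.factorial_zero,
        Nat.cast_one] at h0
      exact measureReal_nonneg.trans h0
    have hlt : (t * A) ^ 2 < 1 := by rw [← sq_abs]; exact pow_lt_one₀ (abs_nonneg _) ht two_ne_zero
    have hsum : Summable fun k : ℕ => C * ((t * A) ^ 2) ^ k :=
      (summable_geometric_of_lt_one (sq_nonneg _) hlt).mul_left C
    rw [← ENNReal.ofReal_tsum_of_nonneg (fun k => by positivity) hsum]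
    exact ENNReal.ofReal_lt_top
  have hci : Integrable (fun x : ℝ => 2 * Real.cosh (t * x)) μ := by
    refine Integrable.const_mul ⟨by fun_prop, ?_⟩ 2
    rw [hasFiniteIntegral_iff_ofReal (ae_of_all _ fun x => (Real.cosh_pos _).le)]
    exact hcosh
  refine hci.mono' (by fun_prop) (ae_of_all _ fun x => ?_)
  rw [Real.norm_of_nonneg (Real.exp_pos _).le, Real.cosh_eq]
  have := Real.exp_pos (-(t * x))
  linarith

theorem zero_mem_interior_integrableExpSet {μ : Measure ℝ} [IsFiniteMeasure μ] {C A : ℝ}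
    (hint : ∀ k : ℕ, Integrable (fun x : ℝ => x ^ k) μ)
    (hle : ∀ k : ℕ, ∫ x, x ^ (2 * k) ∂μ ≤ C * A ^ (2 * k) * (2 * k).factorial) :
    (0 : ℝ) ∈ interior (integrableExpSet id μ) := by
  rw [mem_interior_iff_mem_nhds, Metric.mem_nhds_iff]
  -- The `+ 1` keeps the radius meaningful when `A = 0`.
  refine ⟨1 / (|A| + 1), by positivity, fun t ht => ?_⟩
  rw [Metric.mem_ball, Real.dist_eq, sub_zero, lt_div_iff₀ (by positivity)] at ht
  refine integrable_exp_of_moment_le hint hle ?_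
  rw [abs_mul]
  nlinarith [abs_nonneg t, abs_nonneg A]

/-- A measure whose moments grow at most like factorials is determined by its moments. -/
theorem measure_eq_of_moment_eq {μ ν : Measure ℝ} [IsFiniteMeasure μ] [IsFiniteMeasure ν]
    {C A : ℝ} (hμ : ∀ k : ℕ, Integrable (fun x : ℝ => x ^ k) μ)
    (hν : ∀ k : ℕ, Integrable (fun x : ℝ => x ^ k) ν)
    (heq : ∀ k : ℕ, ∫ x, x ^ k ∂μ = ∫ x, x ^ k ∂ν)
    (hle : ∀ k : ℕ, ∫ x, x ^ (2 * k) ∂μ ≤ C * A ^ (2 * k) * (2 * k).factorial) : μ = ν := by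
  have hμ0 := zero_mem_interior_integrableExpSet hμ hle
  have hν0 := zero_mem_interior_integrableExpSet hν fun k => by rw [← heq]; exact hle k
  -- Both complex moment generating functions are analytic on the vertical strip over `I`, and their
  -- derivatives at `0` are the moments. By the identity theorem they agree on the strip, in
  -- particular on the imaginary axis, where they are the characteristic functions.
  set I := interior (integrableExpSet id μ) ∩ interior (integrableExpSet id ν) with hI
  have h0 : (0 : ℂ).re ∈ I := ⟨hμ0, hν0⟩
  have han1 : AnalyticOnNhd ℂ (complexMGF id μ) {z | z.re ∈ I} :=
    analyticOnNhd_complexMGF.mono fun z hz => hz.1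
  have han2 : AnalyticOnNhd ℂ (complexMGF id ν) {z | z.re ∈ I} :=
    analyticOnNhd_complexMGF.mono fun z hz => hz.2
  have hconv : IsPreconnected {z : ℂ | z.re ∈ I} :=
    ((convex_integrableExpSet.interior.inter convex_integrableExpSet.interior).linear_preimage
      Complex.reLm).isPreconnected
  have hder : ∀ n : ℕ, iteratedDeriv n (complexMGF id μ) 0 = iteratedDeriv n (complexMGF id ν) 0 := by
    intro n
    rw [iteratedDeriv_complexMGF (by simpa using hμ0), iteratedDeriv_complexMGF (by simpa using hν0)]
    simp only [id, zero_mul, Complex.exp_zero, mul_one]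
    have h1 : ∀ ρ : Measure ℝ, ∫ x : ℝ, (x : ℂ) ^ n ∂ρ = ((∫ x : ℝ, x ^ n ∂ρ : ℝ) : ℂ) := by
      intro ρ
      rw [← integral_complex_ofReal]
      simp
    rw [h1, h1, heq]
  have hev : complexMGF id μ =ᶠ[𝓝 0] complexMGF id ν := by
    have e1 := (han1 0 h0).hasFPowerSeriesAt.eventually_hasSum
    have e2 := (han2 0 h0).hasFPowerSeriesAt.eventually_hasSum
    filter_upwards [e1, e2] with y h1 h2
    simp only [hder] at h1
    simpa using h1.unique h2
  have hEq := han1.eqOn_of_preconnected_of_eventuallyEq han2 hconv h0 hev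
  refine Measure.ext_of_charFun (funext fun t => ?_)
  rw [← complexMGF_id_mul_I, ← complexMGF_id_mul_I]
  exact hEq (by simpa using h0)

/-- Truncating `y` at level `R` costs at most `y ^ 2 / R`. -/
theorem abs_sub_truncate_le {y R : ℝ} (hR : 0 < R) : |y - max (-R) (min R y)| ≤ y ^ 2 / R := by
  rw [le_div_iff₀ hR]
  rcases le_total R y with h | h
  · rw [min_eq_left h, max_eq_right (by linarith), abs_of_nonneg (by linarith)]
    nlinarith
  · rw [min_eq_right h]
    rcases le_total (-R) y with h' | h'
    · rw [max_eq_right h']; simp; positivity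
    · rw [max_eq_left h', abs_of_nonpos (by linarith)]
      nlinarith

/-- Under weak convergence, convergence of all moments passes to the limit. -/
theorem moment_eq_of_tendsto {ν : ℕ → ProbabilityMeasure ℝ} {μ : ProbabilityMeasure ℝ} {m : ℕ → ℝ}
    (hint : ∀ j k, Integrable (fun x : ℝ => x ^ k) (ν j : Measure ℝ))
    (hm : ∀ k, Tendsto (fun j => ∫ x, x ^ k ∂(ν j : Measure ℝ)) atTop (𝓝 (m k)))
    (hlim : Tendsto ν atTop (𝓝 μ)) (k : ℕ) :
    Integrable (fun x : ℝ => x ^ k) (μ : Measure ℝ) ∧ ∫ x, x ^ k ∂(μ : Measure ℝ) = m k := by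
  -- Nonnegative powers are lower semicontinuous under weak convergence (portmanteau), so even
  -- moments of the limit are finite; all others follow from `|y| ≤ 1 + y²`.
  have heven : ∀ k : ℕ, Integrable (fun x : ℝ => (x ^ k) ^ 2) (μ : Measure ℝ) := by
    intro k
    refine ⟨by fun_prop, ?_⟩
    rw [hasFiniteIntegral_iff_ofReal (ae_of_all _ fun x => sq_nonneg _)]
    refine (lintegral_le_liminf_lintegral_of_forall_isOpen_measure_le_liminf_measure
      (μs := fun j => (ν j : Measure ℝ)) (f := fun x : ℝ => (x ^ k) ^ 2) (by fun_prop)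
      (fun x => sq_nonneg _)
      fun G hG => ProbabilityMeasure.le_liminf_measure_open_of_tendsto hlim hG).trans_lt ?_
    have : Tendsto (fun j => ∫⁻ x, ENNReal.ofReal ((x ^ k) ^ 2) ∂(ν j : Measure ℝ)) atTop
        (𝓝 (ENNReal.ofReal (m (k * 2)))) := by
      have h1 := (ENNReal.continuous_ofReal.tendsto _).comp (hm (k * 2))
      refine h1.congr fun j => ?_
      simp only [Function.comp_apply, pow_mul]
      rw [ofReal_integral_eq_lintegral_ofReal (by simpa only [pow_mul] using hint j (k * 2))
        (ae_of_all _ fun x => sq_nonneg _)]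
    rw [this.liminf_eq]
    exact ENNReal.ofReal_lt_top
  have hi : Integrable (fun x : ℝ => x ^ k) (μ : Measure ℝ) := by
    have hc : Integrable (fun x : ℝ => 1 + (x ^ k) ^ 2) (μ : Measure ℝ) :=
      (integrable_const 1).add (heven k)
    refine hc.mono' (by fun_prop) (ae_of_all _ fun x => ?_)
    rw [Real.norm_eq_abs]
    nlinarith [sq_nonneg (|x ^ k| - 1), sq_abs (x ^ k)]
  refine ⟨hi, ?_⟩
  -- compare with truncations, for an arbitrary probability measure
  have htrunc : ∀ (ρ : ProbabilityMeasure ℝ) (R : ℝ), 0 < R →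
      Integrable (fun x : ℝ => x ^ k) (ρ : Measure ℝ) →
      Integrable (fun x : ℝ => (x ^ k) ^ 2) (ρ : Measure ℝ) →
      |∫ x, x ^ k ∂(ρ : Measure ℝ) - ∫ x, max (-R) (min R (x ^ k)) ∂(ρ : Measure ℝ)|
        ≤ (∫ x, (x ^ k) ^ 2 ∂(ρ : Measure ℝ)) / R := by
    intro ρ R hR h1 h2
    have h3 : Integrable (fun x : ℝ => max (-R) (min R (x ^ k))) (ρ : Measure ℝ) := by
      refine (integrable_const R).mono' (by fun_prop) (ae_of_all _ fun x => ?_)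
      rw [Real.norm_eq_abs, abs_le]
      exact ⟨le_max_left _ _, max_le (by linarith) (min_le_left _ _)⟩
    rw [← integral_sub h1 h3, ← integral_div]
    refine (abs_integral_le_integral_abs).trans (integral_mono (h1.sub h3).abs (h2.div_const R) ?_)
    intro x
    exact abs_sub_truncate_le hR
  -- Weak convergence applies to the truncation at level `R`, which is bounded and continuous; the
  -- truncation errors are controlled by moments of order `2k` divided by `R`, and `R → ∞` removes
  -- them.
  have hbound : ∀ R : ℝ, 0 < R → |m k - ∫ x, x ^ k ∂(μ : Measure ℝ)|
      ≤ (m (k * 2) + ∫ x, (x ^ k) ^ 2 ∂(μ : Measure ℝ)) / R := by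
    intro R hR
    let φ : ℝ →ᵇ ℝ := BoundedContinuousFunction.ofNormedAddCommGroup
      (fun x => max (-R) (min R (x ^ k))) (by fun_prop) R (fun x => by
        rw [Real.norm_eq_abs, abs_le]
        exact ⟨le_max_left _ _, max_le (by linarith) (min_le_left _ _)⟩)
    have h1 := ProbabilityMeasure.tendsto_iff_forall_integral_tendsto.1 hlim φ
    have h2 : |m k - ∫ x, max (-R) (min R (x ^ k)) ∂(μ : Measure ℝ)| ≤ m (k * 2) / R := by
      refine le_of_tendsto_of_tendsto ((hm k).sub h1).abs ((hm (k * 2)).div_const R)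
        (Eventually.of_forall fun j => ?_)
      have := htrunc (ν j) R hR (hint j k) (by simpa only [pow_mul] using hint j (k * 2))
      simp only [pow_mul]
      exact this
    have h3 := htrunc μ R hR hi (heven k)
    rw [add_div]
    rw [abs_sub_comm] at h3
    calc _ ≤ _ := abs_sub_le _ _ _
      _ ≤ _ := add_le_add h2 h3
  have hlim0 : Tendsto (fun R : ℝ => (m (k * 2) + ∫ x, (x ^ k) ^ 2 ∂(μ : Measure ℝ)) / R) atTop
      (𝓝 0) := tendsto_const_nhds.div_atTop tendsto_id
  have : |m k - ∫ x, x ^ k ∂(μ : Measure ℝ)| ≤ 0 :=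
    ge_of_tendsto hlim0 ((eventually_gt_atTop 0).mono hbound)
  have := abs_eq_zero.1 (le_antisymm this (abs_nonneg _))
  linarith

/-- Probability measures with convergent moments have a weakly convergent subsequence. -/
theorem exists_tendsto_subseq_of_moments {ν : ℕ → ProbabilityMeasure ℝ} {m : ℕ → ℝ}
    (hint : ∀ j k, Integrable (fun x : ℝ => x ^ k) (ν j : Measure ℝ))
    (hm : ∀ k, Tendsto (fun j => ∫ x, x ^ k ∂(ν j : Measure ℝ)) atTop (𝓝 (m k))) :
    ∃ (μ : ProbabilityMeasure ℝ) (φ : ℕ → ℕ), StrictMono φ ∧ Tendsto (ν ∘ φ) atTop (𝓝 μ) := by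
  -- Tightness: the convergent second moments are bounded, so Chebyshev's inequality bounds the
  -- tails uniformly in `j`, and Prokhorov's theorem applies.
  obtain ⟨B, hB⟩ := (hm 2).bddAbove_range
  have hB' : ∀ j, ∫ x, x ^ 2 ∂(ν j : Measure ℝ) ≤ B := fun j => hB ⟨j, rfl⟩
  have hmem : ∀ (j n : ℕ), ν j (Metric.closedBall (0 : ℝ) ((n : ℝ) + 1))ᶜ
      ≤ (B / ((n : ℝ) + 1) ^ 2).toNNReal := by
    intro j n
    rw [← ENNReal.coe_le_coe, ProbabilityMeasure.ennreal_coeFn_eq_coeFn_toMeasure]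
    have hn : (0 : ℝ) < (n : ℝ) + 1 := by positivity
    have hsub : (Metric.closedBall (0 : ℝ) ((n : ℝ) + 1))ᶜ
        ⊆ {x : ℝ | ENNReal.ofReal (((n : ℝ) + 1) ^ 2) ≤ ENNReal.ofReal (x ^ 2)} := by
      intro x hx
      simp only [mem_compl_iff, Metric.mem_closedBall, dist_zero_right, not_le,
        Real.norm_eq_abs] at hx
      apply ENNReal.ofReal_le_ofReal
      rw [← sq_abs x]
      gcongr
    refine (measure_mono hsub).trans ((meas_ge_le_lintegral_div (by fun_prop)
      (by simpa using hn.ne') ENNReal.ofReal_ne_top).trans ?_)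
    rw [← ofReal_integral_eq_lintegral_ofReal (hint j 2) (ae_of_all _ fun x => sq_nonneg _),
      ← ENNReal.ofReal_div_of_pos (by positivity)]
    exact ENNReal.ofReal_le_ofReal (by gcongr; exact hB' j)
  have hu : Tendsto (fun n : ℕ => (B / ((n : ℝ) + 1) ^ 2).toNNReal) atTop (𝓝 0) := by
    rw [← Real.toNNReal_zero]
    refine (continuous_real_toNNReal.tendsto 0).comp (tendsto_const_nhds.div_atTop ?_)
    refine (tendsto_pow_atTop two_ne_zero).comp ?_
    exact tendsto_atTop_add_const_right _ _ tendsto_natCast_atTop_atTop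
  have hcomp := isCompact_setOfPred_probabilityMeasure_mass_eq_compl_isCompact_le (E := ℝ)
    (K := fun n : ℕ => Metric.closedBall 0 ((n : ℝ) + 1)) hu
    (fun n => isCompact_closedBall _ _) (Or.inl inferInstance)
  obtain ⟨μ, -, φ, hφ, h⟩ := hcomp.isSeqCompact (x := ν) hmem
  exact ⟨μ, φ, hφ, h⟩

/-- The method of moments: for a limit with factorially growing moments, convergence of the moments
implies weak convergence. -/
theorem tendsto_of_tendsto_moments {ν : ℕ → ProbabilityMeasure ℝ} {μ : ProbabilityMeasure ℝ}
    {C A : ℝ} (hμ : ∀ k : ℕ, Integrable (fun x : ℝ => x ^ k) (μ : Measure ℝ))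
    (hle : ∀ k : ℕ, ∫ x, x ^ (2 * k) ∂(μ : Measure ℝ) ≤ C * A ^ (2 * k) * (2 * k).factorial)
    (hint : ∀ j k, Integrable (fun x : ℝ => x ^ k) (ν j : Measure ℝ))
    (hm : ∀ k, Tendsto (fun j => ∫ x, x ^ k ∂(ν j : Measure ℝ)) atTop
      (𝓝 (∫ x, x ^ k ∂(μ : Measure ℝ)))) :
    Tendsto ν atTop (𝓝 μ) := by
  -- Every subsequence has a further subsequence with a weak limit; that limit has the moments of
  -- `μ`, hence equals `μ`.
  refine tendsto_of_subseq_tendsto fun ns hns => ?_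
  obtain ⟨μ', φ, hφ, hlim⟩ := exists_tendsto_subseq_of_moments (ν := ν ∘ ns)
    (fun j k => hint (ns j) k) (fun k => (hm k).comp hns)
  have hmom := moment_eq_of_tendsto (ν := (ν ∘ ns) ∘ φ) (fun j k => hint (ns (φ j)) k)
    (fun k => ((hm k).comp hns).comp hφ.tendsto_atTop) hlim
  have : (μ : Measure ℝ) = μ' :=
    measure_eq_of_moment_eq hμ (fun k => (hmom k).1) (fun k => (hmom k).2.symm) hle
  have : μ = μ' := Subtype.ext this
  exact ⟨φ, this ▸ hlim⟩

/-- Quantitative form: closeness of finitely many moments forces closeness of the integral of a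
given bounded continuous function. -/
theorem exists_moment_tolerance {μ : ProbabilityMeasure ℝ} {C A : ℝ}
    (hμ : ∀ k : ℕ, Integrable (fun x : ℝ => x ^ k) (μ : Measure ℝ))
    (hle : ∀ k : ℕ, ∫ x, x ^ (2 * k) ∂(μ : Measure ℝ) ≤ C * A ^ (2 * k) * (2 * k).factorial)
    (f : ℝ →ᵇ ℝ) {ε : ℝ} (hε : 0 < ε) :
    ∃ (K : ℕ) (δ : ℝ), 0 < δ ∧ ∀ ν : ProbabilityMeasure ℝ,
      (∀ k : ℕ, Integrable (fun x : ℝ => x ^ k) (ν : Measure ℝ)) →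
      (∀ k ≤ K, |∫ x, x ^ k ∂(ν : Measure ℝ) - ∫ x, x ^ k ∂(μ : Measure ℝ)| ≤ δ) →
      |∫ x, f x ∂(ν : Measure ℝ) - ∫ x, f x ∂(μ : Measure ℝ)| ≤ ε := by
  by_contra! hcon
  -- Letting the number of moments and the precision vary together with `j` produces one sequence
  -- along which every moment converges.
  choose ν hint hclose hfar using fun j : ℕ => hcon j (1 / ((j : ℝ) + 1)) (by positivity)
  have hm : ∀ k, Tendsto (fun j => ∫ x, x ^ k ∂(ν j : Measure ℝ)) atTop
      (𝓝 (∫ x, x ^ k ∂(μ : Measure ℝ))) := by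
    intro k
    rw [tendsto_iff_dist_tendsto_zero]
    refine squeeze_zero' (Eventually.of_forall fun j => dist_nonneg) ?_
      tendsto_one_div_add_atTop_nhds_zero_nat
    filter_upwards [eventually_ge_atTop k] with j hj
    exact hclose j k hj
  have h := ProbabilityMeasure.tendsto_iff_forall_integral_tendsto.1
    (tendsto_of_tendsto_moments hμ hle hint hm) f
  obtain ⟨j, hj⟩ := ((Metric.tendsto_nhds.1 h) ε hε).exists
  exact absurd hj (not_lt.2 (hfar j).le)

/-! ### Walks on growing bipartite graphs -/

/-- Vertices of the bipartite graph of a matrix: `(false, i)` is the `i`-th row and `(true, j)` the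
`j`-th column. -/
abbrev Vtx := Bool × ℕ

/-- The vertices touched by a finite set of edges. -/
def verts (S : Finset (Sym2 Vtx)) : Finset Vtx := S.biUnion Sym2.toFinset

/-- The neighbours of `x` in a finite set of edges. -/
def nbrs (S : Finset (Sym2 Vtx)) (x : Vtx) : Finset Vtx := {u ∈ verts S | s(x, u) ∈ S}

theorem mem_verts_iff {S : Finset (Sym2 Vtx)} {a : Vtx} : a ∈ verts S ↔ ∃ b, s(a, b) ∈ S := by
  simp only [verts, Finset.mem_biUnion, Sym2.mem_toFinset]
  constructor
  · rintro ⟨e, he, ha⟩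
    obtain ⟨b, rfl⟩ := Sym2.mem_iff_exists.1 ha
    exact ⟨b, he⟩
  · rintro ⟨b, hb⟩
    exact ⟨_, hb, by simp⟩

theorem left_mem_verts {S : Finset (Sym2 Vtx)} {a b : Vtx} (h : s(a, b) ∈ S) : a ∈ verts S :=
  mem_verts_iff.2 ⟨b, h⟩

theorem right_mem_verts {S : Finset (Sym2 Vtx)} {a b : Vtx} (h : s(a, b) ∈ S) : b ∈ verts S :=
  left_mem_verts (Sym2.eq_swap ▸ h)

@[simp] theorem mem_nbrs {S : Finset (Sym2 Vtx)} {x u : Vtx} : u ∈ nbrs S x ↔ s(x, u) ∈ S := by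
  simp only [nbrs, Finset.mem_filter, and_iff_right_iff_imp]
  exact right_mem_verts

@[simp] theorem verts_empty : verts ∅ = ∅ := rfl

theorem verts_insert (S : Finset (Sym2 Vtx)) (a b : Vtx) :
    verts (insert s(a, b) S) = insert a (insert b (verts S)) := by
  ext v
  simp [verts, or_assoc]

theorem verts_union (S T : Finset (Sym2 Vtx)) : verts (S ∪ T) = verts S ∪ verts T := by
  ext v
  simp only [mem_verts_iff, Finset.mem_union]
  exact exists_or

theorem card_nbrs_le (S : Finset (Sym2 Vtx)) (x : Vtx) : (nbrs S x).card ≤ S.card := by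
  refine Finset.card_le_card_of_injOn (fun u => s(x, u)) (fun u hu => by simpa using hu) ?_
  intro u _ v _ h
  exact Sym2.congr_right.1 h

theorem card_verts_le (S : Finset (Sym2 Vtx)) : (verts S).card ≤ 2 * S.card := by
  refine (Finset.card_biUnion_le_card_mul _ _ 2 fun e _ => ?_).trans (mul_comm _ _).le
  rw [Sym2.card_toFinset]
  split_ifs <;> omega

/-- A vertex of type `b` outside a finite set. -/
def freshVtx (b : Bool) (F : Finset Vtx) : Vtx := (b, F.sup Prod.snd + 1)

theorem freshVtx_notMem (b : Bool) (F : Finset Vtx) : freshVtx b F ∉ F := by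
  intro h
  have h1 : (freshVtx b F).2 ≤ F.sup Prod.snd := Finset.le_sup (f := Prod.snd) h
  have h2 : (freshVtx b F).2 = F.sup Prod.snd + 1 := rfl
  omega

/-- `u` can be attached to `x` as a new vertex, other than `y`, of the opposite type. -/
structure IsFresh (S : Finset (Sym2 Vtx)) (x y u : Vtx) : Prop where
  type_eq : u.1 = !x.1
  notMem : u ∉ verts S
  ne_target : u ≠ y

theorem IsFresh.ne {S : Finset (Sym2 Vtx)} {x y u : Vtx} (h : IsFresh S x y u) : u ≠ x := by
  rintro rfl
  have := h.type_eq
  cases u.1 <;> simp_all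

/-- The canonical fresh vertex. -/
def nextVtx (S : Finset (Sym2 Vtx)) (x y : Vtx) : Vtx := freshVtx (!x.1) (insert y (verts S))

theorem isFresh_nextVtx (S : Finset (Sym2 Vtx)) (x y : Vtx) : IsFresh S x y (nextVtx S x y) := by
  have := freshVtx_notMem (!x.1) (insert y (verts S))
  rw [Finset.mem_insert, not_or] at this
  exact ⟨rfl, this.2, this.1⟩

/-- The weighted number of walks of length `L` from `x` to `y` on an edge set growing along the
walk: each step uses an edge already present, with weight `1`, or an edge to a new vertex, with
weight `κ x.1`. -/
noncomputable def growingWalks (κ : Bool → ℝ) :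
    ℕ → Finset (Sym2 Vtx) → Vtx → Vtx → ℝ
  | 0, _, x, y => if x = y then 1 else 0
  | L + 1, S, x, y => ∑ u ∈ nbrs S x, growingWalks κ L S u y +
      κ x.1 * growingWalks κ L (insert s(x, nextVtx S x y) S) (nextVtx S x y) y

theorem nbrs_image (σ : Equiv.Perm Vtx) (S : Finset (Sym2 Vtx)) (x : Vtx) :
    nbrs (S.image (Sym2.map σ)) (σ x) = (nbrs S x).image σ := by
  ext v
  obtain ⟨v, rfl⟩ := σ.surjective v
  simp only [mem_nbrs, Finset.mem_image, EmbeddingLike.apply_eq_iff_eq, exists_eq_right]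
  constructor
  · rintro ⟨e, he, h⟩
    rw [← Sym2.map_mk] at h
    rwa [← Sym2.map.injective σ.injective h]
  · exact fun h => ⟨_, h, by simp⟩

theorem mem_verts_image {σ : Equiv.Perm Vtx} {S : Finset (Sym2 Vtx)} {x : Vtx} :
    σ x ∈ verts (S.image (Sym2.map σ)) ↔ x ∈ verts S := by
  rw [mem_verts_iff, mem_verts_iff]
  constructor
  · rintro ⟨b, hb⟩
    obtain ⟨b, rfl⟩ := σ.surjective b
    rw [← mem_nbrs, nbrs_image] at hb
    simp only [Finset.mem_image, mem_nbrs, EmbeddingLike.apply_eq_iff_eq, exists_eq_right] at hb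
    exact ⟨b, hb⟩
  · rintro ⟨b, hb⟩
    exact ⟨σ b, Finset.mem_image.2 ⟨_, hb, by simp⟩⟩

theorem image_swap_of_notMem {S : Finset (Sym2 Vtx)} {u v : Vtx} (hu : u ∉ verts S)
    (hv : v ∉ verts S) : S.image (Sym2.map (Equiv.swap u v)) = S := by
  have h : ∀ e ∈ S, Sym2.map (Equiv.swap u v) e = e := by
    intro e he
    induction e using Sym2.ind with
    | _ a b =>
      have ha := left_mem_verts he
      have hb := right_mem_verts he
      have key : ∀ w ∈ verts S, Equiv.swap u v w = w := fun w hw =>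
        Equiv.swap_apply_of_ne_of_ne (fun h => hu (h ▸ hw)) (fun h => hv (h ▸ hw))
      rw [Sym2.map_mk, key a ha, key b hb]
  rw [Finset.image_congr (g := id) fun e he => h e he, Finset.image_id]

/-- Swapping two fresh vertices fixes `S`, `x` and `y`, so relabelling invariance at length `L`
identifies the two counts. That invariance is a hypothesis because the induction proving it for
length `L + 1` needs this statement for length `L`. -/
theorem growingWalks_fresh_of_map {κ : Bool → ℝ} {L : ℕ}
    (ih : ∀ (σ : Equiv.Perm Vtx), (∀ v, (σ v).1 = v.1) → ∀ S x y,
      growingWalks κ L (S.image (Sym2.map σ)) (σ x) (σ y) = growingWalks κ L S x y)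
    {S : Finset (Sym2 Vtx)} {x y u v : Vtx} (hu : IsFresh S x y u) (hv : IsFresh S x y v) :
    growingWalks κ L (insert s(x, u) S) u y = growingWalks κ L (insert s(x, v) S) v y := by
  have hσ : ∀ w, (Equiv.swap u v w).1 = w.1 := by
    intro w
    rw [Equiv.swap_apply_def]
    split_ifs with h1 h2
    · rw [h1, hu.type_eq, hv.type_eq]
    · rw [h2, hu.type_eq, hv.type_eq]
    · rfl
  have := ih (Equiv.swap u v) hσ (insert s(x, u) S) u y
  rw [← this, Finset.image_insert, image_swap_of_notMem hu.notMem hv.notMem, Sym2.map_mk,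
    Equiv.swap_apply_left, Equiv.swap_apply_of_ne_of_ne hu.ne.symm hv.ne.symm,
    Equiv.swap_apply_of_ne_of_ne hu.ne_target.symm hv.ne_target.symm]

/-- `growingWalks` is invariant under relabelling. -/
theorem growingWalks_map (κ : Bool → ℝ) (L : ℕ) : ∀ (σ : Equiv.Perm Vtx),
    (∀ v, (σ v).1 = v.1) → ∀ S x y,
      growingWalks κ L (S.image (Sym2.map σ)) (σ x) (σ y) = growingWalks κ L S x y := by
  induction L with
  | zero => intro σ _ S x y; simp [growingWalks]
  | succ L ih =>
    intro σ hσ S x y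
    rw [growingWalks, growingWalks, nbrs_image, Finset.sum_image (fun a _ b _ h => σ.injective h),
      hσ x]
    congr 1
    · exact Finset.sum_congr rfl fun u _ => ih σ hσ S u y
    congr 1
    -- `nextVtx` does not commute with `σ`. Its value on the image is pulled back to some fresh `u`,
    -- which may replace `nextVtx S x y`.
    obtain ⟨u, hu⟩ := σ.surjective (nextVtx (S.image (Sym2.map σ)) (σ x) (σ y))
    have hf := isFresh_nextVtx (S.image (Sym2.map σ)) (σ x) (σ y)
    rw [← hu] at hf ⊢
    have hfu : IsFresh S x y u := by
      refine ⟨?_, fun h => hf.notMem (mem_verts_image.2 h), fun h => hf.ne_target (by rw [h])⟩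
      rw [← hσ u, hf.type_eq, hσ]
    rw [← growingWalks_fresh_of_map ih hfu (isFresh_nextVtx S x y),
      ← ih σ hσ (insert s(x, u) S), Finset.image_insert, Sym2.map_mk]

theorem growingWalks_fresh (κ : Bool → ℝ) (L : ℕ) {S : Finset (Sym2 Vtx)} {x y u v : Vtx}
    (hu : IsFresh S x y u) (hv : IsFresh S x y v) :
    growingWalks κ L (insert s(x, u) S) u y = growingWalks κ L (insert s(x, v) S) v y :=
  growingWalks_fresh_of_map (growingWalks_map κ L) hu hv

theorem growingWalks_closed_eq (κ : Bool → ℝ) (L : ℕ) {x y : Vtx} (h : x.1 = y.1) :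
    growingWalks κ L ∅ x x = growingWalks κ L ∅ y y := by
  have := growingWalks_map κ L (Equiv.swap x y) (fun w => by
    rw [Equiv.swap_apply_def]
    split_ifs with h1 h2
    · rw [h1, h]
    · rw [h2, h]
    · rfl) ∅ x x
  simpa using this.symm

/-- Edges in other components do not matter. -/
theorem growingWalks_union (κ : Bool → ℝ) (L : ℕ) : ∀ (S T : Finset (Sym2 Vtx)) (x y : Vtx),
    Disjoint (verts S) (insert x (insert y (verts T))) →
      growingWalks κ L (S ∪ T) x y = growingWalks κ L T x y := by
  induction L with
  | zero => intro S T x y _; simp [growingWalks]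
  | succ L ih =>
    intro S T x y hd
    have hn : nbrs (S ∪ T) x = nbrs T x := by
      ext v
      simp only [mem_nbrs, Finset.mem_union, or_iff_right_iff_imp]
      intro h
      exact absurd (Finset.mem_insert_self x _) (Finset.disjoint_left.1 hd (left_mem_verts h))
    have hf := isFresh_nextVtx (S ∪ T) x y
    -- A vertex fresh for the union is fresh for `T`, so both walks can be continued by the same new
    -- vertex, which keeps `S` disjoint from the rest.
    have hf' : IsFresh T x y (nextVtx (S ∪ T) x y) :=
      ⟨hf.type_eq, fun h => hf.notMem (by rw [verts_union]; exact Finset.mem_union_right _ h),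
        hf.ne_target⟩
    rw [growingWalks, growingWalks, hn,
      growingWalks_fresh κ L (isFresh_nextVtx T x y) hf', ← Finset.union_insert]
    congr 1
    · refine Finset.sum_congr rfl fun u hu => ih S T u y (hd.mono_right ?_)
      have := right_mem_verts (mem_nbrs.1 hu)
      intro w hw
      simp only [Finset.mem_insert] at hw ⊢
      rcases hw with rfl | hw
      · exact Or.inr (Or.inr this)
      · exact Or.inr hw
    · rw [ih]
      rw [Finset.disjoint_left] at hd ⊢
      intro w hw
      have h1 := hd hw
      have h2 : w ≠ nextVtx (S ∪ T) x y := by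
        rintro rfl
        exact hf.notMem (by rw [verts_union]; exact Finset.mem_union_left _ hw)
      simp only [Finset.mem_insert, not_or, verts_insert] at h1 ⊢
      tauto

/-- A step adds at most one edge, so the degrees met along the walk are at most `s + L`. The
uniformity in `S`, `x`, `y` is what the error estimates below rely on. -/
theorem exists_abs_growingWalks_le (κ : Bool → ℝ) (L s : ℕ) :
    ∃ K : ℝ, 0 ≤ K ∧ ∀ (S : Finset (Sym2 Vtx)), S.card ≤ s → ∀ x y,
      |growingWalks κ L S x y| ≤ K := by
  induction L generalizing s with
  | zero =>
    refine ⟨1, zero_le_one, fun S _ x y => ?_⟩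
    simp only [growingWalks]
    split_ifs <;> simp
  | succ L ih =>
    obtain ⟨K, hK0, hK⟩ := ih (s + 1)
    refine ⟨s * K + (|κ true| + |κ false|) * K, by positivity, fun S hS x y => ?_⟩
    rw [growingWalks]
    refine (abs_add_le _ _).trans (add_le_add ?_ ?_)
    · refine (Finset.abs_sum_le_sum_abs _ _).trans ?_
      refine (Finset.sum_le_card_nsmul _ _ K fun u _ => hK S (by omega) u y).trans ?_
      rw [nsmul_eq_mul]
      have := (card_nbrs_le S x).trans hS
      gcongr
    · rw [abs_mul]
      have h1 : |κ x.1| ≤ |κ true| + |κ false| := by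
        cases x.1 <;> simp
      gcongr
      exact hK _ ((Finset.card_insert_le _ _).trans (by omega)) _ _

theorem growingWalks_nonneg {κ : Bool → ℝ} (hκ : ∀ b, 0 ≤ κ b) (L : ℕ) (S : Finset (Sym2 Vtx))
    (x y : Vtx) : 0 ≤ growingWalks κ L S x y := by
  induction L generalizing S x with
  | zero => simp only [growingWalks]; split_ifs <;> simp
  | succ L ih =>
    rw [growingWalks]
    have := ih (insert s(x, nextVtx S x y) S) (nextVtx S x y)
    have := hκ x.1
    have := Finset.sum_nonneg fun u (_ : u ∈ nbrs S x) => ih S u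
    positivity

/-! ### Trees -/

/-- `S` is a tree with root `r` (or empty) and `δ` is the depth on it. -/
structure IsTreeDepth (S : Finset (Sym2 Vtx)) (r : Vtx) (δ : Vtx → ℕ) : Prop where
  root : δ r = 0
  type_eq : ∀ a b, s(a, b) ∈ S → b.1 = !a.1
  eq_root : ∀ a ∈ verts S, δ a = 0 → a = r
  adj : ∀ a b, s(a, b) ∈ S → δ b = δ a + 1 ∨ δ a = δ b + 1
  parent_unique : ∀ a b b', s(a, b) ∈ S → s(a, b') ∈ S → δ b < δ a → δ b' < δ a → b = b'
  parent_exists : ∀ a ∈ verts S, δ a ≠ 0 → ∃ b, s(a, b) ∈ S ∧ δ b < δ a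

theorem isTreeDepth_empty (r : Vtx) : IsTreeDepth ∅ r fun _ => 0 := by
  constructor <;> simp

theorem mem_insert_edge_iff_of_ne {S : Finset (Sym2 Vtx)} {x u a b : Vtx} (ha : a ≠ u)
    (hb : b ≠ u) : s(a, b) ∈ insert s(x, u) S ↔ s(a, b) ∈ S := by
  rw [Finset.mem_insert, or_iff_right]
  intro h
  rcases Sym2.eq_iff.1 h with ⟨_, h⟩ | ⟨h, _⟩
  · exact hb h
  · exact ha h

theorem mem_insert_edge_new_iff {S : Finset (Sym2 Vtx)} {x u b : Vtx} (hu : u ∉ verts S)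
    (hx : u ≠ x) : s(u, b) ∈ insert s(x, u) S ↔ b = x := by
  rw [Finset.mem_insert, or_iff_left fun h => hu (left_mem_verts h)]
  constructor
  · intro h
    rcases Sym2.eq_iff.1 h with ⟨h, _⟩ | ⟨_, h⟩
    · exact absurd h hx
    · exact h
  · rintro rfl
    exact Sym2.eq_swap

/-- Attaching a leaf to a tree. -/
theorem IsTreeDepth.attach {S : Finset (Sym2 Vtx)} {r : Vtx} {δ : Vtx → ℕ}
    (h : IsTreeDepth S r δ) {x u : Vtx} (hx : x ∈ insert r (verts S))
    (hu : IsFresh S x r u) :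
    IsTreeDepth (insert s(x, u) S) r (Function.update δ u (δ x + 1)) := by
  have hux := hu.ne
  have hδx : Function.update δ u (δ x + 1) x = δ x := Function.update_of_ne hux.symm _ _
  have hxr : δ x = 0 → x = r := by
    intro h0
    rcases Finset.mem_insert.1 hx with h1 | h1
    · exact h1
    · exact h.eq_root x h1 h0
  refine ⟨?_, ?_, ?_, ?_, ?_, ?_⟩
  · rw [Function.update_of_ne hu.ne_target.symm, h.root]
  · intro a b hab
    rcases Finset.mem_insert.1 hab with h1 | h1
    · rcases Sym2.eq_iff.1 h1 with ⟨rfl, rfl⟩ | ⟨rfl, rfl⟩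
      · exact hu.type_eq
      · rw [hu.type_eq, Bool.not_not]
    · exact h.type_eq a b h1
  · intro a ha h0
    rcases eq_or_ne a u with rfl | hau
    · simp at h0
    · rw [Function.update_of_ne hau] at h0
      rw [verts_insert] at ha
      simp only [Finset.mem_insert, hau, false_or] at ha
      rcases ha with rfl | ha
      · exact hxr h0
      · exact h.eq_root a ha h0
  · intro a b hab
    rcases eq_or_ne a u with rfl | hau
    · obtain rfl := (mem_insert_edge_new_iff hu.notMem hux).1 hab
      right
      rw [Function.update_self, hδx]
    rcases eq_or_ne b u with rfl | hbu
    · rw [Sym2.eq_swap (a := a)] at hab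
      obtain rfl := (mem_insert_edge_new_iff hu.notMem hux).1 hab
      left
      rw [Function.update_self, hδx]
    rw [Function.update_of_ne hau, Function.update_of_ne hbu]
    exact h.adj a b ((mem_insert_edge_iff_of_ne hau hbu).1 hab)
  · intro a b b' hab hab' hb hb'
    rcases eq_or_ne a u with rfl | hau
    · rw [(mem_insert_edge_new_iff hu.notMem hux).1 hab,
        (mem_insert_edge_new_iff hu.notMem hux).1 hab']
    have key : ∀ b, s(a, b) ∈ insert s(x, u) S →
        Function.update δ u (δ x + 1) b < Function.update δ u (δ x + 1) a → b ≠ u := by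
      rintro b hab hb rfl
      rw [Sym2.eq_swap (a := a)] at hab
      obtain rfl := (mem_insert_edge_new_iff hu.notMem hux).1 hab
      rw [Function.update_self, hδx] at hb
      omega
    have hbu := key b hab hb
    have hbu' := key b' hab' hb'
    rw [Function.update_of_ne hau, Function.update_of_ne hbu] at hb
    rw [Function.update_of_ne hau, Function.update_of_ne hbu'] at hb'
    exact h.parent_unique a b b' ((mem_insert_edge_iff_of_ne hau hbu).1 hab)
      ((mem_insert_edge_iff_of_ne hau hbu').1 hab') hb hb'
  · intro a ha h0
    rcases eq_or_ne a u with rfl | hau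
    · exact ⟨x, (mem_insert_edge_new_iff hu.notMem hux).2 rfl, by
        rw [Function.update_self, hδx]; omega⟩
    rw [Function.update_of_ne hau] at h0 ⊢
    have ha' : a ∈ verts S := by
      rw [verts_insert] at ha
      simp only [Finset.mem_insert, hau, false_or] at ha
      rcases ha with rfl | ha
      · rcases Finset.mem_insert.1 hx with rfl | h1
        · exact absurd h.root h0
        · exact h1
      · exact ha
    obtain ⟨b, hb, hlt⟩ := h.parent_exists a ha' h0
    have hbu : b ≠ u := by
      rintro rfl
      exact hu.notMem (right_mem_verts hb)
    exact ⟨b, (mem_insert_edge_iff_of_ne hau hbu).2 hb, by rwa [Function.update_of_ne hbu]⟩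

/-- The children of `x` in a tree with depth `δ`. -/
def children (S : Finset (Sym2 Vtx)) (δ : Vtx → ℕ) (x : Vtx) : Finset Vtx :=
  {u ∈ nbrs S x | ¬ δ u < δ x}

theorem IsTreeDepth.depth_of_mem_children {S : Finset (Sym2 Vtx)} {r : Vtx} {δ : Vtx → ℕ}
    (h : IsTreeDepth S r δ) {x u : Vtx} (hu : u ∈ children S δ x) : δ u = δ x + 1 := by
  simp only [children, Finset.mem_filter, mem_nbrs] at hu
  rcases h.adj x u hu.1 with h1 | h1 <;> omega

theorem mem_verts_of_mem_children {S : Finset (Sym2 Vtx)} {δ : Vtx → ℕ} {x u : Vtx}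
    (hu : u ∈ children S δ x) : u ∈ verts S :=
  right_mem_verts (mem_nbrs.1 (Finset.mem_filter.1 hu).1)

/-- Sums over the neighbours of the root run over the children. -/
theorem IsTreeDepth.sum_nbrs_root {S : Finset (Sym2 Vtx)} {r : Vtx} {δ : Vtx → ℕ}
    (_ : IsTreeDepth S r δ) {x : Vtx} (hx : δ x = 0) (F : Vtx → ℝ) :
    ∑ u ∈ nbrs S x, F u = ∑ u ∈ children S δ x, F u := by
  rw [children, Finset.filter_true_of_mem fun u _ => by omega]

/-- Sums over the neighbours of a non-root vertex: the parent and the children. -/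
theorem IsTreeDepth.sum_nbrs_of_parent {S : Finset (Sym2 Vtx)} {r : Vtx} {δ : Vtx → ℕ}
    (h : IsTreeDepth S r δ) {x v : Vtx} (hv : s(x, v) ∈ S) (hlt : δ v < δ x) (F : Vtx → ℝ) :
    ∑ u ∈ nbrs S x, F u = F v + ∑ u ∈ children S δ x, F u := by
  rw [← Finset.sum_filter_add_sum_filter_not (nbrs S x) (fun u => δ u < δ x), children]
  congr 1
  have : {u ∈ nbrs S x | δ u < δ x} = {v} := by
    ext u
    simp only [Finset.mem_filter, mem_nbrs, Finset.mem_singleton]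
    constructor
    · rintro ⟨h1, h2⟩
      exact h.parent_unique x u v h1 hv h2 hlt
    · rintro rfl
      exact ⟨hv, hlt⟩
  rw [this, Finset.sum_singleton]

/-- Growth bound for closed walks on growing trees. -/
theorem growingWalks_tree_le {κ : Bool → ℝ} (hκ : ∀ b, 0 ≤ κ b) {M ρ : ℝ} (hM : ∀ b, κ b ≤ M)
    (hρ : 0 < ρ) {N : ℕ} (hN : N + M ≤ ρ ^ 2) {r : Vtx} (L : ℕ) :
    ∀ (S : Finset (Sym2 Vtx)) (δ : Vtx → ℕ) (x : Vtx), IsTreeDepth S r δ →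
      x ∈ insert r (verts S) → S.card + L ≤ N →
      growingWalks κ L S x r * ρ ^ δ x ≤ (2 * ρ) ^ L := by
  induction L with
  | zero =>
    intro S δ x hT _ _
    simp only [growingWalks]
    split_ifs with h
    · simp [h, hT.root]
    · simp
  | succ L ih =>
    intro S δ x hT hx hc
    -- With the weight `ρ` to the power of the depth, a step to the parent costs a factor `ρ` and a
    -- step to a child `1 / ρ`. Known and new children together weigh at most `N + M ≤ ρ²`, hence
    -- also cost at most `ρ`; the total is `2ρ` per step.
    have hchild : ∑ u ∈ children S δ x, growingWalks κ L S u r * ρ ^ δ x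
        ≤ S.card * ((2 * ρ) ^ L / ρ) := by
      refine (Finset.sum_le_card_nsmul _ _ ((2 * ρ) ^ L / ρ) fun u hu => ?_).trans ?_
      · rw [le_div_iff₀ hρ, mul_assoc, ← pow_succ, ← hT.depth_of_mem_children hu]
        exact ih S δ u hT (Finset.mem_insert_of_mem (mem_verts_of_mem_children hu)) (by omega)
      · rw [nsmul_eq_mul]
        have := (Finset.card_filter_le (nbrs S x) fun u => ¬ δ u < δ x).trans (card_nbrs_le S x)
        rw [children]
        gcongr
    have hfresh := isFresh_nextVtx S x r
    have hnew : κ x.1 * growingWalks κ L (insert s(x, nextVtx S x r) S) (nextVtx S x r) r * ρ ^ δ x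
        ≤ M * ((2 * ρ) ^ L / ρ) := by
      have h1 := ih _ _ (nextVtx S x r) (hT.attach hx hfresh)
        (by simp [verts_insert]) ((Nat.add_le_add_right (Finset.card_insert_le _ _) L).trans (by omega))
      rw [Function.update_self, pow_succ, ← mul_assoc, ← le_div_iff₀ hρ] at h1
      rw [mul_assoc]
      have h2 := hκ x.1
      exact mul_le_mul (hM _) h1 (mul_nonneg (growingWalks_nonneg hκ _ _ _ _) (by positivity))
        (h2.trans (hM _))
    have hup : S.card * ((2 * ρ) ^ L / ρ) + M * ((2 * ρ) ^ L / ρ) ≤ ρ * (2 * ρ) ^ L := by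
      have hS : (S.card : ℝ) ≤ N := by exact_mod_cast (by omega : S.card ≤ N)
      calc S.card * ((2 * ρ) ^ L / ρ) + M * ((2 * ρ) ^ L / ρ)
          = (S.card + M) * ((2 * ρ) ^ L / ρ) := by ring
        _ ≤ ρ ^ 2 * ((2 * ρ) ^ L / ρ) := by gcongr; linarith
        _ = ρ * (2 * ρ) ^ L := by field_simp
    have hpow : (2 * ρ) ^ (L + 1) = ρ * (2 * ρ) ^ L + ρ * (2 * ρ) ^ L := by ring
    rw [growingWalks, hpow, add_mul]
    by_cases h0 : δ x = 0
    · rw [hT.sum_nbrs_root h0, Finset.sum_mul]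
      have : 0 ≤ ρ * (2 * ρ) ^ L := by positivity
      linarith
    · have hxS : x ∈ verts S := by
        rcases Finset.mem_insert.1 hx with rfl | h1
        · exact absurd hT.root h0
        · exact h1
      obtain ⟨v, hv, hlt⟩ := hT.parent_exists x hxS h0
      have hδ : δ x = δ v + 1 := by rcases hT.adj x v hv with h1 | h1 <;> omega
      have hpar : growingWalks κ L S v r * ρ ^ δ x ≤ ρ * (2 * ρ) ^ L := by
        have := ih S δ v hT (Finset.mem_insert_of_mem (right_mem_verts hv)) (by omega)
        rw [hδ, pow_succ]
        calc _ = ρ * (growingWalks κ L S v r * ρ ^ δ v) := by ring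
          _ ≤ _ := by gcongr
      rw [hT.sum_nbrs_of_parent hv hlt, add_mul, Finset.sum_mul]
      linarith

/-- The closed walks grow at most like factorials. -/
theorem growingWalks_closed_le {κ : Bool → ℝ} (hκ : ∀ b, 0 ≤ κ b) {M : ℝ} (hM : ∀ b, κ b ≤ M)
    (hM0 : 0 < M) (r : Vtx) (k : ℕ) :
    growingWalks κ (2 * k) ∅ r r ≤ Real.exp M * (4 * Real.exp 2) ^ k * k.factorial := by
  have hpos : (0 : ℝ) < (2 * k : ℕ) + M := by positivity
  -- At most `2k` edges are ever explored, so `ρ² = 2k + M` is the smallest admissible choice.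
  have h := growingWalks_tree_le hκ hM (Real.sqrt_pos.2 hpos) (N := 2 * k)
    (Real.sq_sqrt hpos.le).ge (2 * k) ∅ _ r (isTreeDepth_empty r) (by simp) (by simp)
  rw [pow_zero, mul_one, pow_mul, mul_pow, Real.sq_sqrt hpos.le] at h
  refine h.trans ?_
  -- The bound `yᵏ / k! ≤ exp y` at `y = 2k + M` turns `(2k + M)ᵏ` into a factorial times a
  -- geometric factor.
  have h2 := Real.pow_div_factorial_le_exp _ hpos.le k
  rw [div_le_iff₀ (by positivity), Real.exp_add] at h2
  have h3 : Real.exp ((2 * k : ℕ) : ℝ) = Real.exp 2 ^ k := by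
    rw [← Real.exp_nat_mul]
    congr 1
    push_cast
    ring
  rw [h3] at h2
  calc ((2 : ℝ) ^ 2 * ((2 * k : ℕ) + M)) ^ k = 4 ^ k * ((2 * k : ℕ) + M) ^ k := by
        rw [mul_pow]; norm_num
    _ ≤ 4 ^ k * (Real.exp 2 ^ k * Real.exp M * k.factorial) := by gcongr
    _ = _ := by rw [mul_pow]; ring

/-! ### Walks on the sparse random bipartite graph -/

/-- The number of vertices of each type in the graph of an `n × m` matrix. -/
def side (n m : ℕ) : Bool → ℕ
  | false => n
  | true => m

/-- `x` is a vertex of the graph of an `n × m` matrix. -/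
def IsVtx (n m : ℕ) (x : Vtx) : Prop := x.2 < side n m x.1

/-- The vertices of the type opposite to that of `x`. -/
def oppVerts (n m : ℕ) (x : Vtx) : Finset Vtx := {!x.1} ×ˢ Finset.range (side n m !x.1)

theorem mem_oppVerts {n m : ℕ} {x u : Vtx} : u ∈ oppVerts n m x ↔ u.1 = !x.1 ∧ IsVtx n m u := by
  simp only [oppVerts, Finset.mem_product, Finset.mem_singleton, Finset.mem_range, IsVtx]
  constructor
  · rintro ⟨h1, h2⟩; exact ⟨h1, by rwa [h1]⟩
  · rintro ⟨h1, h2⟩; exact ⟨h1, by rwa [← h1]⟩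

theorem card_oppVerts (n m : ℕ) (x : Vtx) : (oppVerts n m x).card = side n m !x.1 := by
  simp [oppVerts]

/-- All edges of `S` are edges of the complete bipartite graph `K_{n,m}`. -/
def IsBipartite (n m : ℕ) (S : Finset (Sym2 Vtx)) : Prop :=
  ∀ a b, s(a, b) ∈ S → b ∈ oppVerts n m a

theorem isBipartite_empty (n m : ℕ) : IsBipartite n m ∅ := by simp [IsBipartite]

theorem IsBipartite.insert_edge {n m : ℕ} {S : Finset (Sym2 Vtx)} (hS : IsBipartite n m S)
    {x u : Vtx} (hx : IsVtx n m x) (hu : u ∈ oppVerts n m x) :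
    IsBipartite n m (insert s(x, u) S) := by
  intro a b hab
  rcases Finset.mem_insert.1 hab with h | h
  · rcases Sym2.eq_iff.1 h with ⟨rfl, rfl⟩ | ⟨rfl, rfl⟩
    · exact hu
    · rw [mem_oppVerts] at hu ⊢
      exact ⟨by rw [hu.1, Bool.not_not], hx⟩
  · exact hS a b h

/-- The expected number of walks of length `L` from `x` to `y`, weighted by a functional `Φ` of the
edges explored, when each edge outside `S` is present with probability `p`. -/
noncomputable def sparseWalks (n m : ℕ) (p : ℝ) (Φ : Finset (Sym2 Vtx) → ℝ) :
    ℕ → Finset (Sym2 Vtx) → Vtx → Vtx → ℝ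
  | 0, S, x, y => if x = y then Φ S else 0
  | L + 1, S, x, y => ∑ u ∈ oppVerts n m x,
      if s(x, u) ∈ S then sparseWalks n m p Φ L S u y
      else p * sparseWalks n m p Φ L (insert s(x, u) S) u y

theorem IsBipartite.nbrs_eq {n m : ℕ} {S : Finset (Sym2 Vtx)} (hS : IsBipartite n m S) (x : Vtx) :
    {u ∈ oppVerts n m x | s(x, u) ∈ S} = nbrs S x := by
  ext u
  simp only [Finset.mem_filter, mem_nbrs, and_iff_right_iff_imp]
  exact hS x u

/-- The effect of the vertices which are not new, and of the error in the weight, on one step. -/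
theorem abs_sum_growingWalks_sub_le {κ : Bool → ℝ} {n m L s : ℕ} {p K : ℝ} (hp : 0 ≤ p)
    (hK : ∀ S : Finset (Sym2 Vtx), S.card ≤ s + 1 → ∀ x y, |growingWalks κ L S x y| ≤ K)
    {S : Finset (Sym2 Vtx)} (hS : IsBipartite n m S) (hs : S.card ≤ s) (x y : Vtx) :
    |∑ u ∈ oppVerts n m x with s(x, u) ∉ S, p * growingWalks κ L (insert s(x, u) S) u y
      - κ x.1 * growingWalks κ L (insert s(x, nextVtx S x y) S) (nextVtx S x y) y|
      ≤ (p * (5 * s + 2) + |side n m (!x.1) * p - κ x.1|) * K := by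
  set F := growingWalks κ L (insert s(x, nextVtx S x y) S) (nextVtx S x y) y with hF
  have hins : ∀ u, (insert s(x, u) S).card ≤ s + 1 :=
    fun u => (Finset.card_insert_le _ _).trans (by omega)
  have hK0 : 0 ≤ K := (abs_nonneg _).trans (hK _ (hins x) x y)
  have hFK : |F| ≤ K := hK _ (hins _) _ _
  set R := {u ∈ oppVerts n m x | s(x, u) ∉ S} with hR
  have hcard : (R.card : ℝ) = side n m (!x.1) - (nbrs S x).card := by
    have h1 := Finset.card_filter_add_card_filter_not (s := oppVerts n m x)
      (fun u => s(x, u) ∈ S)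
    rw [hS.nbrs_eq, card_oppVerts] at h1
    rw [eq_sub_iff_add_eq', ← h1]
    push_cast
    rfl
  -- All fresh end points give exactly `F`. The others lie in `verts S` or equal `y`, which leaves
  -- at most `2s + 1` of them, each with error at most `2K`.
  have hsum : |∑ u ∈ R, (growingWalks κ L (insert s(x, u) S) u y - F)| ≤ (2 * s + 1) * (2 * K) := by
    have hsplit : ∑ u ∈ R, (growingWalks κ L (insert s(x, u) S) u y - F)
        = ∑ u ∈ R with u ∈ insert y (verts S),
          (growingWalks κ L (insert s(x, u) S) u y - F) := by
      symm
      refine Finset.sum_filter_of_ne fun u hu hne => ?_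
      by_contra hmem
      rw [Finset.mem_insert, not_or] at hmem
      refine hne (sub_eq_zero.2 (growingWalks_fresh κ L ⟨?_, hmem.2, hmem.1⟩
        (isFresh_nextVtx S x y)))
      exact (mem_oppVerts.1 (Finset.mem_filter.1 hu).1).1
    rw [hsplit]
    refine (Finset.abs_sum_le_sum_abs _ _).trans
      ((Finset.sum_le_card_nsmul _ _ (2 * K) fun u _ => ?_).trans ?_)
    · have h1 := hK _ (hins u) u y
      exact (abs_sub _ _).trans (by linarith)
    · rw [nsmul_eq_mul]
      have h1 : ((Finset.filter (· ∈ insert y (verts S)) R).card : ℝ) ≤ 2 * s + 1 := by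
        have h2 : (Finset.filter (· ∈ insert y (verts S)) R).card ≤ (insert y (verts S)).card :=
          Finset.card_le_card fun u hu => (Finset.mem_filter.1 hu).2
        have h3 := h2.trans (Finset.card_insert_le _ _)
        have h4 := card_verts_le S
        exact_mod_cast h3.trans (by omega)
      gcongr
  -- Three errors: end points that are not fresh, the difference between the total weight and `κ`,
  -- and the at most `s` neighbours excluded from `R`. The first and third account for `2(2s + 1) +
  -- s = 5s + 2`.
  have hid : ∑ u ∈ R, p * growingWalks κ L (insert s(x, u) S) u y - κ x.1 * F
      = p * ∑ u ∈ R, (growingWalks κ L (insert s(x, u) S) u y - F)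
        + (side n m (!x.1) * p - κ x.1) * F - p * (nbrs S x).card * F := by
    rw [Finset.sum_sub_distrib, ← Finset.mul_sum, Finset.sum_const, nsmul_eq_mul, hcard]
    ring
  have hnb : ((nbrs S x).card : ℝ) ≤ s := by exact_mod_cast (card_nbrs_le S x).trans hs
  rw [hid]
  have t1 : |p * ∑ u ∈ R, (growingWalks κ L (insert s(x, u) S) u y - F)|
      ≤ p * ((2 * s + 1) * (2 * K)) := by
    rw [abs_mul, abs_of_nonneg hp]; gcongr
  have t2 : |(side n m (!x.1) * p - κ x.1) * F| ≤ |side n m (!x.1) * p - κ x.1| * K := by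
    rw [abs_mul]; gcongr
  have t3 : |p * (nbrs S x).card * F| ≤ p * s * K := by
    rw [abs_mul, abs_of_nonneg (by positivity)]; gcongr
  refine (abs_sub _ _).trans ((add_le_add (abs_add_le _ _) le_rfl).trans ?_)
  linarith

/-- `Φ n → φ`, uniformly on edge sets of bounded size. -/
def TendstoOnEdges (m : ℕ → ℕ) (Φ : ℕ → Finset (Sym2 Vtx) → ℝ) (φ : ℝ) : Prop :=
  ∀ (s : ℕ) (ε : ℝ), 0 < ε → ∀ᶠ n in atTop, ∀ S, IsBipartite n (m n) S → S.card ≤ s →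
    |Φ n S - φ| ≤ ε

/-- Walks on the sparse graph converge to walks on the growing graph, uniformly in the explored
edges and in the end points. -/
theorem sparseWalks_sub_growingWalks_le {κ : Bool → ℝ} {m : ℕ → ℕ} {p : ℕ → ℝ}
    (hp0 : ∀ n, 0 ≤ p n) (hp : Tendsto p atTop (𝓝 0))
    (hside : ∀ b, Tendsto (fun n => (side n (m n) (!b) : ℝ) * p n) atTop (𝓝 (κ b)))
    {Φ : ℕ → Finset (Sym2 Vtx) → ℝ} {φ : ℝ} (hΦ : TendstoOnEdges m Φ φ) (L : ℕ) :
    ∀ (s : ℕ) (ε : ℝ), 0 < ε → ∀ᶠ n in atTop, ∀ S, IsBipartite n (m n) S → S.card ≤ s →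
      ∀ x, IsVtx n (m n) x → ∀ y,
        |sparseWalks n (m n) (p n) (Φ n) L S x y - φ * growingWalks κ L S x y| ≤ ε := by
  induction L with
  | zero =>
    intro s ε hε
    filter_upwards [hΦ s ε hε] with n hn S hS hs x _ y
    simp only [sparseWalks, growingWalks]
    split_ifs
    · simpa using hn S hS hs
    · simpa using hε.le
  | succ L ih =>
    intro s ε hε
    obtain ⟨K, hK0, hK⟩ := exists_abs_growingWalks_le κ L (s + 1)
    set Q := |κ true| + |κ false| + 1 with hQ
    have hQ0 : 0 < Q := by positivity
    -- One step multiplies the error at length `L` by at most `s + Q`: at most `s` known edges, and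
    -- new edges of total weight at most `Q`. This takes half of `ε`; the replacement of the new
    -- edges by a single fresh one takes the other half.
    have hε' : 0 < ε / (2 * (s + Q)) := by positivity
    have hres : ∀ b, ∀ᶠ n in atTop,
        |φ| * ((p n * (5 * s + 2) + |side n (m n) (!b) * p n - κ b|) * K) ≤ ε / 2 := by
      intro b
      have h1 : Tendsto (fun n => |φ| * ((p n * (5 * s + 2)
          + |side n (m n) (!b) * p n - κ b|) * K)) atTop
          (𝓝 (|φ| * ((0 * (5 * s + 2) + |κ b - κ b|) * K))) :=
        ((((hp.mul_const _).add ((hside b).sub_const _).abs).mul_const _).const_mul _)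
      simp only [zero_mul, sub_self, abs_zero, add_zero, mul_zero] at h1
      exact h1.eventually_le_const (by positivity)
    have hNQ : ∀ b, ∀ᶠ n in atTop, (side n (m n) (!b) : ℝ) * p n ≤ Q := by
      intro b
      refine (hside b).eventually_le_const ?_
      have h1 := le_abs_self (κ b)
      have h2 := abs_nonneg (κ true)
      have h3 := abs_nonneg (κ false)
      cases b <;> linarith
    filter_upwards [ih (s + 1) _ hε', hres true, hres false, hNQ true, hNQ false] with
      n hn hrt hrf hNt hNf S hS hs x hx y
    have hrb : |φ| * ((p n * (5 * s + 2) + |side n (m n) (!x.1) * p n - κ x.1|) * K) ≤ ε / 2 := by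
      cases x.1
      · exact hrf
      · exact hrt
    have hNb : (side n (m n) (!x.1) : ℝ) * p n ≤ Q := by
      cases x.1
      · exact hNf
      · exact hNt
    have hkey := abs_sum_growingWalks_sub_le (hp0 n) hK hS hs x y
    set F := growingWalks κ L (insert s(x, nextVtx S x y) S) (nextVtx S x y) y with hF
    rw [sparseWalks, growingWalks, Finset.sum_ite, hS.nbrs_eq]
    set R := {u ∈ oppVerts n (m n) x | s(x, u) ∉ S} with hR
    have t1 : |∑ u ∈ nbrs S x, (sparseWalks n (m n) (p n) (Φ n) L S u y
        - φ * growingWalks κ L S u y)| ≤ s * (ε / (2 * (s + Q))) := by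
      refine (Finset.abs_sum_le_sum_abs _ _).trans
        ((Finset.sum_le_card_nsmul _ _ _ fun u hu => hn S hS (by omega) u ?_ y).trans ?_)
      · exact (mem_oppVerts.1 (hS x u (mem_nbrs.1 hu))).2
      · rw [nsmul_eq_mul]
        have : ((nbrs S x).card : ℝ) ≤ s := by exact_mod_cast (card_nbrs_le S x).trans hs
        gcongr
    have t2 : |∑ u ∈ R, p n * (sparseWalks n (m n) (p n) (Φ n) L (insert s(x, u) S) u y
        - φ * growingWalks κ L (insert s(x, u) S) u y)| ≤ Q * (ε / (2 * (s + Q))) := by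
      refine (Finset.abs_sum_le_sum_abs _ _).trans
        ((Finset.sum_le_card_nsmul _ _ (p n * (ε / (2 * (s + Q)))) fun u hu => ?_).trans ?_)
      · have hu' := (Finset.mem_filter.1 hu).1
        rw [abs_mul, abs_of_nonneg (hp0 n)]
        exact mul_le_mul_of_nonneg_left (hn _ (hS.insert_edge hx hu')
          ((Finset.card_insert_le _ _).trans (by omega)) u (mem_oppVerts.1 hu').2 y) (hp0 n)
      · rw [nsmul_eq_mul, ← mul_assoc]
        have h1 : (R.card : ℝ) ≤ side n (m n) (!x.1) := by
          rw [← card_oppVerts]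
          exact_mod_cast Finset.card_filter_le _ _
        have h2 := hp0 n
        exact mul_le_mul_of_nonneg_right ((mul_le_mul_of_nonneg_right h1 h2).trans hNb) hε'.le
    have t3 : |φ * (∑ u ∈ R, p n * growingWalks κ L (insert s(x, u) S) u y - κ x.1 * F)|
        ≤ ε / 2 := by
      rw [abs_mul]
      exact (mul_le_mul_of_nonneg_left hkey (abs_nonneg φ)).trans hrb
    have hid : ∑ u ∈ nbrs S x, sparseWalks n (m n) (p n) (Φ n) L S u y
        + ∑ u ∈ R, p n * sparseWalks n (m n) (p n) (Φ n) L (insert s(x, u) S) u y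
        - φ * (∑ u ∈ nbrs S x, growingWalks κ L S u y + κ x.1 * F)
        = ∑ u ∈ nbrs S x, (sparseWalks n (m n) (p n) (Φ n) L S u y
            - φ * growingWalks κ L S u y)
          + ∑ u ∈ R, p n * (sparseWalks n (m n) (p n) (Φ n) L (insert s(x, u) S) u y
            - φ * growingWalks κ L (insert s(x, u) S) u y)
          + φ * (∑ u ∈ R, p n * growingWalks κ L (insert s(x, u) S) u y - κ x.1 * F) := by
      have h1 : ∀ u, p n * (sparseWalks n (m n) (p n) (Φ n) L (insert s(x, u) S) u y
            - φ * growingWalks κ L (insert s(x, u) S) u y)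
          = p n * sparseWalks n (m n) (p n) (Φ n) L (insert s(x, u) S) u y
            - φ * (p n * growingWalks κ L (insert s(x, u) S) u y) := fun u => by ring
      simp only [h1, Finset.sum_sub_distrib, ← Finset.mul_sum]
      ring
    rw [hid]
    calc _ ≤ _ := abs_add_three _ _ _
      _ ≤ s * (ε / (2 * (s + Q))) + Q * (ε / (2 * (s + Q))) + ε / 2 := by linarith
      _ = ε := by field_simp; ring

/-- The average number of closed walks of length `L` at the rows. -/
noncomputable def meanClosedWalks (n m : ℕ) (p : ℝ) (Φ : Finset (Sym2 Vtx) → ℝ) (L : ℕ)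
    (S : Finset (Sym2 Vtx)) : ℝ :=
  (n : ℝ)⁻¹ * ∑ i ∈ Finset.range n, sparseWalks n m p Φ L S (false, i) (false, i)

/-- At most `2s` rows touch `S`, and they vanish in the average; the walks of `growingWalks` from
any other row do not see `S`, which makes the limit independent of `S`. The conclusion has the form
of the hypothesis on `Φ`, so the lemma can be applied to its own output, which gives second moments.
-/
theorem tendstoOnEdges_meanClosedWalks {κ : Bool → ℝ} {m : ℕ → ℕ} {p : ℕ → ℝ}
    (hp0 : ∀ n, 0 ≤ p n) (hp : Tendsto p atTop (𝓝 0))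
    (hside : ∀ b, Tendsto (fun n => (side n (m n) (!b) : ℝ) * p n) atTop (𝓝 (κ b)))
    {Φ : ℕ → Finset (Sym2 Vtx) → ℝ} {φ : ℝ} (hΦ : TendstoOnEdges m Φ φ) (L : ℕ) :
    TendstoOnEdges m (fun n => meanClosedWalks n (m n) (p n) (Φ n) L)
      (φ * growingWalks κ L ∅ (false, 0) (false, 0)) := by
  intro s ε hε
  obtain ⟨K, hK0, hK⟩ := exists_abs_growingWalks_le κ L s
  set g := growingWalks κ L ∅ (false, 0) (false, 0) with hg
  have hlim : ∀ᶠ n : ℕ in atTop, |φ| * (2 * s * (2 * K)) / (n : ℝ) ≤ ε / 2 :=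
    (tendsto_const_nhds.div_atTop tendsto_natCast_atTop_atTop).eventually_le_const (by positivity)
  filter_upwards [sparseWalks_sub_growingWalks_le hp0 hp hside hΦ L s (ε / 2) (by positivity),
    hlim, eventually_gt_atTop 0] with n hn hsmall hn0 S hS hs
  have hn0' : (0 : ℝ) < n := by exact_mod_cast hn0
  have hloc : ∀ i, (false, i) ∉ verts S → growingWalks κ L S (false, i) (false, i) = g := by
    intro i hi
    have := growingWalks_union κ L S ∅ (false, i) (false, i) (by simpa using hi)
    rw [Finset.union_empty] at this
    rw [this]
    exact growingWalks_closed_eq κ L rfl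
  have t1 : |∑ i ∈ Finset.range n, (sparseWalks n (m n) (p n) (Φ n) L S (false, i) (false, i)
      - φ * growingWalks κ L S (false, i) (false, i))| ≤ n * (ε / 2) := by
    refine (Finset.abs_sum_le_sum_abs _ _).trans
      ((Finset.sum_le_card_nsmul _ _ (ε / 2) fun i hi => ?_).trans ?_)
    · exact hn S hS hs (false, i) (Finset.mem_range.1 hi) _
    · rw [nsmul_eq_mul, Finset.card_range]
  have t2 : |∑ i ∈ Finset.range n, (growingWalks κ L S (false, i) (false, i) - g)|
      ≤ 2 * s * (2 * K) := by
    have hsplit : ∑ i ∈ Finset.range n, (growingWalks κ L S (false, i) (false, i) - g)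
        = ∑ i ∈ Finset.range n with (false, i) ∈ verts S,
          (growingWalks κ L S (false, i) (false, i) - g) := by
      symm
      refine Finset.sum_filter_of_ne fun i _ hne => ?_
      by_contra hmem
      exact hne (sub_eq_zero.2 (hloc i hmem))
    rw [hsplit]
    refine (Finset.abs_sum_le_sum_abs _ _).trans
      ((Finset.sum_le_card_nsmul _ _ (2 * K) fun i _ => ?_).trans ?_)
    · have h1 := hK S hs (false, i) (false, i)
      have h2 := hK ∅ (by simp) (false, 0) (false, 0)
      exact (abs_sub _ _).trans (by linarith)
    · rw [nsmul_eq_mul]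
      have h1 : (Finset.filter (fun i => (false, i) ∈ verts S) (Finset.range n)).card
          ≤ (verts S).card :=
        Finset.card_le_card_of_injOn (fun i => (false, i))
          (fun i hi => (Finset.mem_filter.1 hi).2) (fun i _ j _ h => by simpa using h)
      have h2 : ((Finset.filter (fun i => (false, i) ∈ verts S) (Finset.range n)).card : ℝ)
          ≤ 2 * s := by
        exact_mod_cast (h1.trans (card_verts_le S)).trans (by omega)
      gcongr
  have hid : meanClosedWalks n (m n) (p n) (Φ n) L S - φ * g
      = (n : ℝ)⁻¹ * (∑ i ∈ Finset.range n,
          (sparseWalks n (m n) (p n) (Φ n) L S (false, i) (false, i)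
            - φ * growingWalks κ L S (false, i) (false, i))
        + φ * ∑ i ∈ Finset.range n, (growingWalks κ L S (false, i) (false, i) - g)) := by
    simp only [Finset.sum_sub_distrib, ← Finset.mul_sum, Finset.sum_const, Finset.card_range,
      nsmul_eq_mul, meanClosedWalks]
    field_simp
    ring
  rw [hid, abs_mul, abs_of_pos (inv_pos.2 hn0'), inv_mul_le_iff₀ hn0']
  rw [div_le_iff₀ hn0'] at hsmall
  calc _ ≤ _ := abs_add_le _ _
    _ ≤ n * (ε / 2) + |φ| * (2 * s * (2 * K)) := by
        rw [abs_mul]; gcongr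
    _ ≤ n * ε := by linarith

/-! ### Expectations over the Bernoulli array -/

/-- The edge of an entry of the matrix. -/
def entryEdge {n m : ℕ} (e : Fin n × Fin m) : Sym2 Vtx := s((false, (e.1 : ℕ)), (true, (e.2 : ℕ)))

theorem entryEdge_injective {n m : ℕ} : Function.Injective (entryEdge (n := n) (m := m)) := by
  rintro ⟨i, j⟩ ⟨i', j'⟩ h
  rcases Sym2.eq_iff.1 h with ⟨h1, h2⟩ | ⟨h1, _⟩
  · simp only [Prod.mk.injEq, true_and] at h1 h2
    exact Prod.ext (Fin.ext h1) (Fin.ext h2)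
  · simp at h1

theorem exists_entryEdge {n m : ℕ} {x u : Vtx} (hx : IsVtx n m x) (hu : u ∈ oppVerts n m x) :
    ∃ e : Fin n × Fin m, s(x, u) = entryEdge e := by
  obtain ⟨h1, h2⟩ := mem_oppVerts.1 hu
  obtain ⟨b, i⟩ := x
  obtain ⟨b', j⟩ := u
  cases b
  · obtain rfl : b' = true := h1
    exact ⟨(⟨i, hx⟩, ⟨j, h2⟩), rfl⟩
  · obtain rfl : b' = false := h1
    exact ⟨(⟨j, h2⟩, ⟨i, hx⟩), Sym2.eq_swap⟩

/-- The edges of the bipartite graph of a Boolean array. -/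
def arrayEdges {n m : ℕ} (ω : Fin n × Fin m → Bool) : Finset (Sym2 Vtx) :=
  ({e | ω e = true} : Finset (Fin n × Fin m)).image entryEdge

theorem entryEdge_mem_arrayEdges {n m : ℕ} {ω : Fin n × Fin m → Bool} {e : Fin n × Fin m} :
    entryEdge e ∈ arrayEdges ω ↔ ω e = true := by
  simp [arrayEdges, entryEdge_injective.eq_iff]

theorem arrayEdges_update {n m : ℕ} (ω : Fin n × Fin m → Bool) (e : Fin n × Fin m) :
    arrayEdges (Function.update ω e true) = insert (entryEdge e) (arrayEdges ω) := by
  ext a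
  simp only [arrayEdges, Finset.mem_image, Finset.mem_filter, Finset.mem_univ, true_and,
    Finset.mem_insert]
  constructor
  · rintro ⟨e', h, rfl⟩
    rcases eq_or_ne e' e with rfl | hne
    · exact Or.inl rfl
    · rw [Function.update_of_ne hne] at h
      exact Or.inr ⟨e', h, rfl⟩
  · rintro (rfl | ⟨e', h, rfl⟩)
    · exact ⟨e, by simp, rfl⟩
    · refine ⟨e', ?_, rfl⟩
      rcases eq_or_ne e' e with rfl | hne
      · simp
      · rwa [Function.update_of_ne hne]

/-- The success probability of the entries. -/
noncomputable def entryProb (c : ℝ) (n : ℕ) : ℝ := projIcc (0 : ℝ) 1 zero_le_one (c / n)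

instance isProbabilityMeasure_bernoulliArrayLaw (c : ℝ) (n m : ℕ) :
    IsProbabilityMeasure (bernoulliArrayLaw c n m) := by
  unfold bernoulliArrayLaw
  infer_instance

theorem integral_bernoulliArrayLaw (c : ℝ) (n m : ℕ) (f : (Fin n × Fin m → Bool) → ℝ) :
    ∫ ω, f ω ∂bernoulliArrayLaw c n m
      = ∑ ω, (∏ e, if ω e then entryProb c n else 1 - entryProb c n) * f ω := by
  rw [integral_fintype Integrable.of_finite]
  refine Finset.sum_congr rfl fun ω _ => ?_
  rw [smul_eq_mul, measureReal_def, bernoulliArrayLaw, Measure.pi_singleton, ENNReal.toReal_prod]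
  congr 1
  refine Finset.prod_congr rfl fun e _ => ?_
  rw [← measureReal_def]
  cases ω e
  · rw [bernoulliMeasure_real_apply_of_notMem_of_mem _ (measurableSet_singleton _) (by simp)
      (by simp)]
    rfl
  · rw [bernoulliMeasure_real_apply_of_mem_of_notMem _ (measurableSet_singleton _) (by simp)
      (by simp)]
    rfl

/-- Conditioning on an entry being one. -/
theorem integral_ite_entry (c : ℝ) (n m : ℕ) (e : Fin n × Fin m)
    (f : (Fin n × Fin m → Bool) → ℝ) :
    ∫ ω, (if ω e = true then f ω else 0) ∂bernoulliArrayLaw c n m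
      = entryProb c n * ∫ ω, f (Function.update ω e true) ∂bernoulliArrayLaw c n m := by
  rw [integral_bernoulliArrayLaw, integral_bernoulliArrayLaw]
  set q := entryProb c n
  set P : (Fin n × Fin m → Bool) → ℝ :=
    fun ω => ∏ e' ∈ Finset.univ.erase e, if ω e' then q else 1 - q with hP
  have hsplit : ∀ ω : Fin n × Fin m → Bool, (∏ e', if ω e' then q else 1 - q)
      = (if ω e then q else 1 - q) * P ω :=
    fun ω => (Finset.mul_prod_erase _ _ (Finset.mem_univ e)).symm
  have hPu : ∀ ω b, P (Function.update ω e b) = P ω := by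
    intro ω b
    refine Finset.prod_congr rfl fun e' he' => ?_
    rw [Function.update_of_ne (Finset.ne_of_mem_erase he')]
  simp only [hsplit]
  -- Switching the entry `e` on matches the arrays where it is off with those where it is on; the
  -- weights `1 - q` and `q` then add up to `1`.
  have hfalse : ∑ ω : Fin n × Fin m → Bool with ¬ ω e = true,
      (if ω e = true then q else 1 - q) * P ω * f (Function.update ω e true)
      = ∑ ω : Fin n × Fin m → Bool with ω e = true, (1 - q) * P ω * f ω := by
    refine Finset.sum_nbij' (fun ω => Function.update ω e true)
      (fun ω => Function.update ω e false) ?_ ?_ ?_ ?_ ?_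
    · intro ω _; simp
    · intro ω _; simp
    · intro ω hω
      have : ω e = false := by simpa using hω
      rw [Function.update_idem, ← this, Function.update_eq_self]
    · intro ω hω
      have : ω e = true := by simpa using hω
      rw [Function.update_idem, ← this, Function.update_eq_self]
    · intro ω hω
      have : ω e = false := by simpa using hω
      simp [this, hPu]
  rw [← Finset.sum_filter_add_sum_filter_not Finset.univ (fun ω : Fin n × Fin m → Bool => ω e = true)
    (fun ω => (if ω e = true then q else 1 - q) * P ω * f (Function.update ω e true)), hfalse,
    ← Finset.sum_add_distrib, Finset.mul_sum]
  simp only [mul_ite, mul_zero]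
  rw [← Finset.sum_filter]
  refine Finset.sum_congr rfl fun ω hω => ?_
  have h : ω e = true := by simpa using hω
  have hu : Function.update ω e true = ω := by rw [← h, Function.update_eq_self]
  simp only [h, if_true, hu]
  ring

/-- The number of walks of length `L` in a graph. -/
noncomputable def walkCount (n m : ℕ) (G : Finset (Sym2 Vtx)) : ℕ → Vtx → Vtx → ℝ
  | 0, x, y => if x = y then 1 else 0
  | L + 1, x, y => ∑ u ∈ oppVerts n m x, if s(x, u) ∈ G then walkCount n m G L u y else 0

/-- The expected number of walks in the random graph, with the edges of `S` added. -/
theorem integral_walkCount_mul (c : ℝ) (n m : ℕ) (Ψ : Finset (Sym2 Vtx) → ℝ) (L : ℕ) :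
    ∀ (S : Finset (Sym2 Vtx)) (x y : Vtx), IsVtx n m x →
      ∫ ω, walkCount n m (arrayEdges ω ∪ S) L x y * Ψ (arrayEdges ω ∪ S) ∂bernoulliArrayLaw c n m
        = sparseWalks n m (entryProb c n)
          (fun S => ∫ ω, Ψ (arrayEdges ω ∪ S) ∂bernoulliArrayLaw c n m) L S x y := by
  induction L with
  | zero =>
    intro S x y _
    simp only [walkCount, sparseWalks]
    split_ifs <;> simp
  | succ L ih =>
    intro S x y hx
    simp only [walkCount, sparseWalks, Finset.sum_mul]
    rw [integral_finsetSum _ fun u _ => Integrable.of_finite]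
    refine Finset.sum_congr rfl fun u hu => ?_
    have huv := (mem_oppVerts.1 hu).2
    split_ifs with hmem
    · rw [← ih S u y huv]
      refine integral_congr_ae (ae_of_all _ fun ω => ?_)
      simp [hmem]
    -- An unexplored edge: conditioning on its presence yields the factor `p` and moves the edge
    -- into `S`, where later visits are free. The functional `Ψ` then sees it as well.
    · obtain ⟨e, he⟩ := exists_entryEdge hx hu
      rw [← ih _ u y huv, he]
      rw [he] at hmem
      have h1 : ∀ ω : Fin n × Fin m → Bool,
          (if entryEdge e ∈ arrayEdges ω ∪ S then walkCount n m (arrayEdges ω ∪ S) L u y else 0)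
            * Ψ (arrayEdges ω ∪ S)
          = if ω e = true then
              walkCount n m (arrayEdges ω ∪ S) L u y * Ψ (arrayEdges ω ∪ S) else 0 := by
        intro ω
        simp only [Finset.mem_union, hmem, or_false, entryEdge_mem_arrayEdges, ite_mul, zero_mul]
      simp only [h1]
      rw [integral_ite_entry]
      simp only [arrayEdges_update, Finset.insert_union, Finset.union_insert]

/-- The average number of closed walks at the rows. -/
noncomputable def walkMean (n m : ℕ) (G : Finset (Sym2 Vtx)) (L : ℕ) : ℝ :=
  (n : ℝ)⁻¹ * ∑ i ∈ Finset.range n, walkCount n m G L (false, i) (false, i)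

theorem integral_walkMean_mul (c : ℝ) (n m : ℕ) (Ψ : Finset (Sym2 Vtx) → ℝ) (L : ℕ)
    (S : Finset (Sym2 Vtx)) :
    ∫ ω, walkMean n m (arrayEdges ω ∪ S) L * Ψ (arrayEdges ω ∪ S) ∂bernoulliArrayLaw c n m
      = meanClosedWalks n m (entryProb c n)
          (fun S => ∫ ω, Ψ (arrayEdges ω ∪ S) ∂bernoulliArrayLaw c n m) L S := by
  simp only [walkMean, meanClosedWalks, mul_assoc, Finset.sum_mul]
  rw [integral_const_mul, integral_finsetSum _ fun u _ => Integrable.of_finite]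
  congr 1
  exact Finset.sum_congr rfl fun i hi =>
    integral_walkCount_mul c n m Ψ L S (false, i) (false, i) (Finset.mem_range.1 hi)

theorem sum_oppVerts_row {n m : ℕ} (i : ℕ) (F : Vtx → ℝ) :
    ∑ u ∈ oppVerts n m (false, i), F u = ∑ j : Fin m, F (true, (j : ℕ)) := by
  rw [oppVerts, Finset.sum_product, Finset.sum_singleton]
  exact Finset.sum_range fun j => F (true, j)

theorem sum_oppVerts_col {n m : ℕ} (j : ℕ) (F : Vtx → ℝ) :
    ∑ u ∈ oppVerts n m (true, j), F u = ∑ i : Fin n, F (false, (i : ℕ)) := by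
  rw [oppVerts, Finset.sum_product, Finset.sum_singleton]
  exact Finset.sum_range fun i => F (false, i)

/-- Powers of `A Aᵀ` count walks. -/
theorem pow_mul_transpose_apply {n m : ℕ} (ω : Fin n × Fin m → Bool) (k : ℕ) (i i' : Fin n) :
    ((zeroOneMatrix ω * (zeroOneMatrix ω).transpose) ^ k) i i'
      = walkCount n m (arrayEdges ω) (2 * k) (false, (i : ℕ)) (false, (i' : ℕ)) := by
  induction k generalizing i with
  | zero => simp [walkCount, Matrix.one_apply, Fin.ext_iff]
  | succ k ih =>
    rw [pow_succ', Matrix.mul_apply, Nat.mul_succ, walkCount, sum_oppVerts_row]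
    simp only [ih]
    simp only [walkCount, sum_oppVerts_col, Matrix.mul_apply, Matrix.transpose_apply,
      zeroOneMatrix, Matrix.of_apply, Finset.sum_mul]
    rw [Finset.sum_comm]
    refine Finset.sum_congr rfl fun j _ => ?_
    have h1 : s((false, (i : ℕ)), (true, (j : ℕ))) ∈ arrayEdges ω ↔ ω (i, j) = true :=
      entryEdge_mem_arrayEdges (e := (i, j))
    have h2 : ∀ i'' : Fin n, s((true, (j : ℕ)), (false, (i'' : ℕ))) ∈ arrayEdges ω
        ↔ ω (i'', j) = true := fun i'' => by
      rw [Sym2.eq_swap]; exact entryEdge_mem_arrayEdges (e := (i'', j))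
    simp only [h1, h2]
    split_ifs with h
    · refine Finset.sum_congr rfl fun i'' _ => ?_
      split_ifs <;> simp
    · simp

/-! ### Moments of the empirical spectral measure -/

theorem trace_pow_eq_sum_eigenvalues_pow {n : ℕ} {W : Matrix (Fin n) (Fin n) ℝ}
    (hW : W.IsHermitian) (k : ℕ) : (W ^ k).trace = ∑ i, hW.eigenvalues i ^ k := by
  conv_lhs => rw [hW.spectral_theorem, ← map_pow, Unitary.conjStarAlgAut_apply,
    Matrix.trace_mul_comm, ← mul_assoc, Unitary.coe_star_mul_self, one_mul, Matrix.diagonal_pow,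
    Matrix.trace_diagonal]
  simp

theorem integrable_empiricalSpectralMeasure {n : ℕ} {W : Matrix (Fin n) (Fin n) ℝ}
    (hW : W.IsHermitian) (hn : 0 < n) (f : ℝ → ℝ) :
    Integrable f (empiricalSpectralMeasure hW) := by
  refine Integrable.smul_measure ?_ (by simpa using hn.ne')
  exact integrable_finsetSum_measure.2 fun i _ => integrable_dirac (by simp)

theorem integral_empiricalSpectralMeasure {n : ℕ} {W : Matrix (Fin n) (Fin n) ℝ}
    (hW : W.IsHermitian) (f : ℝ → ℝ) :
    ∫ x, f x ∂empiricalSpectralMeasure hW = (n : ℝ)⁻¹ * ∑ i, f (hW.eigenvalues i) := by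
  rw [empiricalSpectralMeasure, integral_smul_measure,
    integral_finsetSum_measure fun i _ => integrable_dirac (by simp)]
  simp

theorem isProbabilityMeasure_empiricalSpectralMeasure {n : ℕ} {W : Matrix (Fin n) (Fin n) ℝ}
    (hW : W.IsHermitian) (hn : 0 < n) : IsProbabilityMeasure (empiricalSpectralMeasure hW) := by
  constructor
  simp only [empiricalSpectralMeasure, Measure.smul_apply, Measure.finsetSum_apply, smul_eq_mul,
    measure_univ, Finset.sum_const, Finset.card_univ, Fintype.card_fin, nsmul_eq_mul, mul_one]
  exact ENNReal.inv_mul_cancel (by simpa using hn.ne') (by simp)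

/-- The moments of the empirical spectral measure of the Wishart matrix count closed walks. -/
theorem moment_empiricalSpectralMeasure (c : ℝ) {n m : ℕ} (ω : Fin n × Fin m → Bool) (k : ℕ) :
    ∫ x, x ^ k ∂empiricalSpectralMeasure (wishart_isHermitian c (zeroOneMatrix ω))
      = c⁻¹ ^ k * walkMean n m (arrayEdges ω) (2 * k) := by
  rw [integral_empiricalSpectralMeasure, ← trace_pow_eq_sum_eigenvalues_pow, wishart, smul_pow,
    Matrix.trace_smul, smul_eq_mul, Matrix.trace, walkMean, Finset.sum_range]
  simp only [Matrix.diag_apply, pow_mul_transpose_apply]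
  ring

/-! ### The limiting spectral law -/

/-- The limiting mean number of new neighbours of a row (`false`) and of a column (`true`). -/
def branching (α c : ℝ) : Bool → ℝ
  | false => α * c
  | true => c

/-- The moments of the limiting spectral law. -/
noncomputable def limitMoment (α c : ℝ) (k : ℕ) : ℝ :=
  c⁻¹ ^ k * growingWalks (branching α c) (2 * k) ∅ (false, 0) (false, 0)

theorem entryProb_nonneg (c : ℝ) (n : ℕ) : 0 ≤ entryProb c n :=
  (projIcc (0 : ℝ) 1 zero_le_one (c / n)).2.1

theorem eventually_entryProb_eq {c : ℝ} (hc : 0 < c) : ∀ᶠ n : ℕ in atTop, entryProb c n = c / n := by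
  filter_upwards [eventually_ge_atTop ⌈c⌉₊, eventually_gt_atTop 0] with n hn hn0
  have h0 : (0 : ℝ) < n := by exact_mod_cast hn0
  have h1 : c ≤ n := (Nat.le_ceil c).trans (by exact_mod_cast hn)
  rw [entryProb, projIcc_of_mem zero_le_one ⟨by positivity, (div_le_one h0).2 h1⟩]

theorem tendsto_entryProb {c : ℝ} (hc : 0 < c) : Tendsto (entryProb c) atTop (𝓝 0) := by
  refine Tendsto.congr' ((eventually_entryProb_eq hc).mono fun n h => h.symm) ?_
  exact tendsto_const_nhds.div_atTop tendsto_natCast_atTop_atTop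

theorem tendsto_side_mul_entryProb {α c : ℝ} (hc : 0 < c) {m : ℕ → ℕ}
    (hm : Tendsto (fun n => (m n : ℝ) / n) atTop (𝓝 α)) (b : Bool) :
    Tendsto (fun n => (side n (m n) (!b) : ℝ) * entryProb c n) atTop (𝓝 (branching α c b)) := by
  cases b
  · refine Tendsto.congr' ?_ (hm.mul_const c)
    filter_upwards [eventually_entryProb_eq hc] with n hn
    rw [hn]
    simp only [side, Bool.not_false]
    ring
  · refine Tendsto.congr' ?_ tendsto_const_nhds
    filter_upwards [eventually_entryProb_eq hc, eventually_gt_atTop 0] with n hn hn0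
    have h0 : (0 : ℝ) < n := by exact_mod_cast hn0
    rw [hn]
    simp only [side, Bool.not_true, branching]
    field_simp

theorem TendstoOnEdges.tendsto_empty {m : ℕ → ℕ} {Φ : ℕ → Finset (Sym2 Vtx) → ℝ} {φ : ℝ}
    (h : TendstoOnEdges m Φ φ) : Tendsto (fun n => Φ n ∅) atTop (𝓝 φ) := by
  rw [Metric.tendsto_nhds]
  intro ε hε
  filter_upwards [h 0 (ε / 2) (by positivity)] with n hn
  have := hn ∅ (isBipartite_empty _ _) (by simp)
  rw [Real.dist_eq]
  linarith

/-- The square is the mean over one walk weighted by the mean over another. Given the edges of the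
first, the expectation of the second still tends to the same constant, so the limit of the second
moment is the square of the limit. -/
theorem tendsto_integral_walkMean {α c : ℝ} (hc : 0 < c) {m : ℕ → ℕ}
    (hm : Tendsto (fun n => (m n : ℝ) / n) atTop (𝓝 α)) (L : ℕ) :
    Tendsto (fun n => ∫ ω, walkMean n (m n) (arrayEdges ω) L ∂bernoulliArrayLaw c n (m n)) atTop
        (𝓝 (growingWalks (branching α c) L ∅ (false, 0) (false, 0))) ∧
      Tendsto (fun n => ∫ ω, walkMean n (m n) (arrayEdges ω) L ^ 2 ∂bernoulliArrayLaw c n (m n))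
        atTop (𝓝 (growingWalks (branching α c) L ∅ (false, 0) (false, 0) ^ 2)) := by
  have hone : TendstoOnEdges m (fun n S => ∫ _ω, (1 : ℝ) ∂bernoulliArrayLaw c n (m n)) 1 := by
    intro s ε hε
    refine Eventually.of_forall fun n S _ _ => ?_
    simpa using hε.le
  have h1 := tendstoOnEdges_meanClosedWalks (entryProb_nonneg c) (tendsto_entryProb hc)
    (tendsto_side_mul_entryProb hc hm) hone L
  have e1 : ∀ n, meanClosedWalks n (m n) (entryProb c n)
      (fun _ => ∫ _ω, (1 : ℝ) ∂bernoulliArrayLaw c n (m n)) L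
      = fun S => ∫ ω, walkMean n (m n) (arrayEdges ω ∪ S) L ∂bernoulliArrayLaw c n (m n) := by
    intro n
    funext S
    rw [← integral_walkMean_mul c n (m n) (fun _ => 1) L S]
    simp
  simp only [e1, one_mul] at h1
  have h2 := tendstoOnEdges_meanClosedWalks (entryProb_nonneg c) (tendsto_entryProb hc)
    (tendsto_side_mul_entryProb hc hm) h1 L
  have e2 : ∀ n, meanClosedWalks n (m n) (entryProb c n)
      (fun S => ∫ ω, walkMean n (m n) (arrayEdges ω ∪ S) L ∂bernoulliArrayLaw c n (m n)) L
      = fun S => ∫ ω, walkMean n (m n) (arrayEdges ω ∪ S) L * walkMean n (m n) (arrayEdges ω ∪ S) L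
        ∂bernoulliArrayLaw c n (m n) := by
    intro n
    funext S
    exact (integral_walkMean_mul c n (m n) (fun G => walkMean n (m n) G L) L S).symm
  simp only [e2] at h2
  refine ⟨by simpa using h1.tendsto_empty, ?_⟩
  simpa only [Finset.union_empty, ← sq] using h2.tendsto_empty

/-- Convergence of the moments in probability. -/
theorem tendsto_measure_moment_sub_gt {α c : ℝ} (hc : 0 < c) {m : ℕ → ℕ}
    (hm : Tendsto (fun n => (m n : ℝ) / n) atTop (𝓝 α)) (k : ℕ) {δ : ℝ} (hδ : 0 < δ) :
    Tendsto (fun n => bernoulliArrayLaw c n (m n)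
      {ω | δ < |∫ x, x ^ k ∂(empiricalSpectralMeasure
        (wishart_isHermitian c (zeroOneMatrix ω))) - limitMoment α c k|}) atTop (𝓝 0) := by
  obtain ⟨h1, h2⟩ := tendsto_integral_walkMean hc hm (2 * k)
  set g := growingWalks (branching α c) (2 * k) ∅ (false, 0) (false, 0) with hg
  -- Convergence in mean square, from `g² - 2g · g + g² = 0`; Chebyshev's inequality then bounds the
  -- probability.
  have hsq : Tendsto (fun n => ∫ ω, (c⁻¹ ^ k * walkMean n (m n) (arrayEdges ω) (2 * k)
      - c⁻¹ ^ k * g) ^ 2 ∂bernoulliArrayLaw c n (m n)) atTop (𝓝 0) := by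
    have h3 := ((h2.sub (h1.const_mul (2 * g))).add_const (g ^ 2)).const_mul ((c⁻¹ ^ k) ^ 2)
    rw [show (c⁻¹ ^ k) ^ 2 * (g ^ 2 - 2 * g * g + g ^ 2) = 0 by ring] at h3
    refine h3.congr fun n => ?_
    have hid : ∀ ω : Fin n × Fin (m n) → Bool,
        (c⁻¹ ^ k * walkMean n (m n) (arrayEdges ω) (2 * k) - c⁻¹ ^ k * g) ^ 2
        = (c⁻¹ ^ k) ^ 2 * (walkMean n (m n) (arrayEdges ω) (2 * k) ^ 2
          - 2 * g * walkMean n (m n) (arrayEdges ω) (2 * k) + g ^ 2) := fun ω => by ring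
    simp only [hid]
    rw [integral_const_mul, integral_add Integrable.of_finite Integrable.of_finite,
      integral_sub Integrable.of_finite Integrable.of_finite, integral_const_mul, integral_const]
    simp
  have hb := (ENNReal.continuous_ofReal.tendsto _).comp (hsq.div_const (δ ^ 2))
  rw [zero_div, ENNReal.ofReal_zero] at hb
  refine tendsto_of_tendsto_of_tendsto_of_le_of_le tendsto_const_nhds hb (fun n => zero_le)
    fun n => ?_
  simp only [moment_empiricalSpectralMeasure, limitMoment, Function.comp_apply]
  rw [ENNReal.ofReal_div_of_pos (by positivity), ofReal_integral_eq_lintegral_ofReal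
    Integrable.of_finite (ae_of_all _ fun ω => sq_nonneg _)]
  refine (measure_mono fun ω hω => ?_).trans (meas_ge_le_lintegral_div
    (measurable_of_finite _).aemeasurable (by simpa using hδ.ne') ENNReal.ofReal_ne_top)
  refine ENNReal.ofReal_le_ofReal ?_
  rw [← sq_abs (_ - _)]
  exact pow_le_pow_left₀ hδ.le (le_of_lt hω) 2

theorem limitMoment_le {α c : ℝ} (hα : 0 < α) (hc : 0 < c) :
    ∃ C A : ℝ, ∀ k : ℕ, limitMoment α c k ≤ C * A ^ k * k.factorial := by
  refine ⟨Real.exp (α * c + c), c⁻¹ * (4 * Real.exp 2), fun k => ?_⟩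
  have hac : 0 < α * c := by positivity
  have h := growingWalks_closed_le (κ := branching α c) (M := α * c + c)
    (by rintro (_ | _) <;> simp only [branching] <;> linarith)
    (by rintro (_ | _) <;> simp only [branching] <;> linarith) (by linarith) (false, 0) k
  rw [limitMoment, mul_pow]
  calc c⁻¹ ^ k * growingWalks (branching α c) (2 * k) ∅ (false, 0) (false, 0)
      ≤ c⁻¹ ^ k * (Real.exp (α * c + c) * (4 * Real.exp 2) ^ k * k.factorial) := by gcongr
    _ = _ := by ring

theorem tendsto_floor_mul_div {α : ℝ} (hα : 0 < α) :
    Tendsto (fun n : ℕ => (⌊α * n⌋₊ : ℝ) / n) atTop (𝓝 α) :=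
  (tendsto_nat_floor_mul_div_atTop hα.le).comp tendsto_natCast_atTop_atTop

/-- With high probability all of the first moments are close to their limits. -/
theorem tendsto_measure_exists_moment_sub_gt {α c : ℝ} (hc : 0 < c) {m : ℕ → ℕ}
    (hm : Tendsto (fun n => (m n : ℝ) / n) atTop (𝓝 α)) (K : ℕ) {δ : ℝ} (hδ : 0 < δ) :
    Tendsto (fun n => bernoulliArrayLaw c n (m n)
      {ω | ∃ k ≤ K, δ < |∫ x, x ^ k ∂(empiricalSpectralMeasure
        (wishart_isHermitian c (zeroOneMatrix ω))) - limitMoment α c k|}) atTop (𝓝 0) := by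
  have hsum : Tendsto (fun n => ∑ k ∈ Finset.range (K + 1), bernoulliArrayLaw c n (m n)
      {ω | δ < |∫ x, x ^ k ∂(empiricalSpectralMeasure
        (wishart_isHermitian c (zeroOneMatrix ω))) - limitMoment α c k|}) atTop (𝓝 0) := by
    rw [← Finset.sum_const_zero (s := Finset.range (K + 1))]
    exact tendsto_finsetSum _ fun k _ => tendsto_measure_moment_sub_gt hc hm k hδ
  refine tendsto_of_tendsto_of_tendsto_of_le_of_le tendsto_const_nhds hsum (fun n => zero_le)
    fun n => ?_
  refine (measure_mono ?_).trans (measure_biUnion_finset_le (Finset.range (K + 1)) _)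
  rintro ω ⟨k, hk, h⟩
  simp only [Finset.mem_range, mem_iUnion]
  exact ⟨k, by omega, h⟩

/-- There is a probability law with the limiting moments. -/
theorem exists_measure_limitMoment {α c : ℝ} (hα : 0 < α) (hc : 0 < c) :
    ∃ μ : ProbabilityMeasure ℝ, ∀ k : ℕ, Integrable (fun x : ℝ => x ^ k) (μ : Measure ℝ) ∧
      ∫ x, x ^ k ∂(μ : Measure ℝ) = limitMoment α c k := by
  -- The event that one of the first `j` moments is off has probability less than `1` for large `n`,
  -- so some array avoids it, and its empirical measure serves as `ν`. Any weak limit point of these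
  -- measures has the limiting moments.
  have hex : ∀ j : ℕ, ∃ ν : ProbabilityMeasure ℝ,
      (∀ k : ℕ, Integrable (fun x : ℝ => x ^ k) (ν : Measure ℝ)) ∧
      ∀ k ≤ j, |∫ x, x ^ k ∂(ν : Measure ℝ) - limitMoment α c k| ≤ 1 / ((j : ℝ) + 1) := by
    intro j
    have h := tendsto_measure_exists_moment_sub_gt hc (tendsto_floor_mul_div hα) j
      (δ := 1 / ((j : ℝ) + 1)) (by positivity)
    obtain ⟨n, hn, hn0⟩ := ((h.eventually_lt_const zero_lt_one).and (eventually_gt_atTop 0)).exists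
    obtain ⟨ω, hω⟩ : ∃ ω, ω ∉ {ω : Fin n × Fin ⌊α * n⌋₊ → Bool | ∃ k ≤ j, 1 / ((j : ℝ) + 1)
        < |∫ x, x ^ k ∂(empiricalSpectralMeasure
          (wishart_isHermitian c (zeroOneMatrix ω))) - limitMoment α c k|} := by
      by_contra! hall
      rw [eq_univ_of_forall hall, measure_univ] at hn
      exact lt_irrefl _ hn
    refine ⟨⟨_, isProbabilityMeasure_empiricalSpectralMeasure
      (wishart_isHermitian c (zeroOneMatrix ω)) hn0⟩,
      fun k => integrable_empiricalSpectralMeasure _ hn0 _, fun k hk => ?_⟩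
    by_contra! hlt
    exact hω ⟨k, hk, hlt⟩
  choose ν hint hclose using hex
  have hm : ∀ k, Tendsto (fun j => ∫ x, x ^ k ∂(ν j : Measure ℝ)) atTop
      (𝓝 (limitMoment α c k)) := by
    intro k
    rw [tendsto_iff_dist_tendsto_zero]
    refine squeeze_zero' (Eventually.of_forall fun j => dist_nonneg) ?_
      tendsto_one_div_add_atTop_nhds_zero_nat
    filter_upwards [eventually_ge_atTop k] with j hj
    exact hclose j k hj
  obtain ⟨μ, φ, hφ, hlim⟩ := exists_tendsto_subseq_of_moments hint hm
  exact ⟨μ, moment_eq_of_tendsto (fun j k => hint (φ j) k)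
    (fun k => (hm k).comp hφ.tendsto_atTop) hlim⟩

/-- A law with the limiting moments is the limiting spectral law. -/
theorem isLimitingSpectralLaw_of_moment {α c : ℝ} (hα : 0 < α) (hc : 0 < c)
    {μ : ProbabilityMeasure ℝ}
    (hμ : ∀ k : ℕ, Integrable (fun x : ℝ => x ^ k) (μ : Measure ℝ) ∧
      ∫ x, x ^ k ∂(μ : Measure ℝ) = limitMoment α c k) :
    IsLimitingSpectralLaw α c μ := by
  obtain ⟨C, A, hle⟩ := limitMoment_le hα hc
  refine ⟨inferInstance, fun m hm f ε hε => ?_⟩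
  obtain ⟨K, δ, hδ, hK⟩ := exists_moment_tolerance (fun k => (hμ k).1)
    (fun k => by rw [(hμ (2 * k)).2]; exact hle (2 * k)) f hε
  refine tendsto_of_tendsto_of_tendsto_of_le_of_le' tendsto_const_nhds
    (tendsto_measure_exists_moment_sub_gt hc hm K hδ) (Eventually.of_forall fun n => zero_le) ?_
  filter_upwards [eventually_gt_atTop 0] with n hn
  refine measure_mono fun ω hω => ?_
  by_contra hcon
  simp only [mem_ofPred_eq, not_exists, not_and, not_lt] at hcon
  have := hK ⟨_, isProbabilityMeasure_empiricalSpectralMeasure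
    (wishart_isHermitian c (zeroOneMatrix ω)) hn⟩
    (fun k => integrable_empiricalSpectralMeasure _ hn _)
    (fun k hk => by rw [(hμ k).2]; exact hcon k hk)
  exact absurd hω (not_lt.2 this)

/-- The limiting spectral law is unique. -/
theorem IsLimitingSpectralLaw.unique {α c : ℝ} (hα : 0 < α) {μ ν : Measure ℝ}
    (hμ : IsLimitingSpectralLaw α c μ) (hν : IsLimitingSpectralLaw α c ν) : μ = ν := by
  have := hμ.1
  have := hν.1
  refine ext_of_forall_integral_eq_of_IsFiniteMeasure fun f => ?_
  by_contra hne
  set ε := |∫ x, f x ∂μ - ∫ x, f x ∂ν| / 2 with hε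
  have hε0 : 0 < ε := by
    have := abs_pos.2 (sub_ne_zero.2 hne)
    positivity
  -- The integrals against `μ` and `ν` differ by `2ε`, while the tolerances add up to `3ε/2`. The
  -- two bad events therefore cover everything, although their probabilities tend to `0`.
  have h := (hμ.2 _ (tendsto_floor_mul_div hα) f ε hε0).add
    (hν.2 _ (tendsto_floor_mul_div hα) f (ε / 2) (by positivity))
  rw [add_zero] at h
  obtain ⟨n, hn⟩ := (h.eventually_lt_const zero_lt_one).exists
  have hcov : (univ : Set (Fin n × Fin ⌊α * n⌋₊ → Bool)) ⊆
      {ω | ε < |(∫ x, f x ∂(empiricalSpectralMeasure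
        (wishart_isHermitian c (zeroOneMatrix ω)))) - (∫ x, f x ∂μ)|} ∪
      {ω | ε / 2 < |(∫ x, f x ∂(empiricalSpectralMeasure
        (wishart_isHermitian c (zeroOneMatrix ω)))) - (∫ x, f x ∂ν)|} := by
    intro ω _
    by_contra hcon
    simp only [mem_union, mem_ofPred_eq, not_or, not_lt] at hcon
    have h1 := abs_sub_le (∫ x, f x ∂μ) (∫ x, f x ∂(empiricalSpectralMeasure
        (wishart_isHermitian c (zeroOneMatrix ω)))) (∫ x, f x ∂ν)
    rw [abs_sub_comm (∫ x, f x ∂μ) (∫ x, f x ∂(empiricalSpectralMeasure _))] at h1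
    linarith [hcon.1, hcon.2]
  have h1 := (measure_mono (μ := bernoulliArrayLaw c n ⌊α * n⌋₊) hcov).trans (measure_union_le _ _)
  rw [measure_univ] at h1
  exact absurd hn (not_lt.2 h1)

theorem isLimitingSpectralLaw_limitingSpectralLaw {α c : ℝ} (hα : 0 < α) (hc : 0 < c) :
    IsLimitingSpectralLaw α c (limitingSpectralLaw α c) := by
  obtain ⟨μ, hμ⟩ := exists_measure_limitMoment hα hc
  have hex : ∃ μ : Measure ℝ, IsLimitingSpectralLaw α c μ :=
    ⟨μ, isLimitingSpectralLaw_of_moment hα hc hμ⟩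
  rw [limitingSpectralLaw, dif_pos hex]
  exact hex.choose_spec

/-- The moments of the limiting spectral law. -/
theorem moment_limitingSpectralLaw {α c : ℝ} (hα : 0 < α) (hc : 0 < c) (k : ℕ) :
    Integrable (fun x : ℝ => x ^ k) (limitingSpectralLaw α c) ∧
      ∫ x, x ^ k ∂limitingSpectralLaw α c = limitMoment α c k := by
  obtain ⟨μ, hμ⟩ := exists_measure_limitMoment hα hc
  rw [(isLimitingSpectralLaw_limitingSpectralLaw hα hc).unique hα
    (isLimitingSpectralLaw_of_moment hα hc hμ)]
  exact hμ k

/-! ### Expansion in the inverse branching rate -/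

/-- Walks on a growing tree with root `r`, a step to the parent having weight `1`, a step to a known
child weight `ε`, and a step to a new child weight `w x.1`. -/
noncomputable def scaledWalks (w : Bool → ℝ) (r : Vtx) (ε : ℝ) :
    ℕ → Finset (Sym2 Vtx) → (Vtx → ℕ) → Vtx → ℝ
  | 0, _, _, x => if x = r then 1 else 0
  | L + 1, S, δ, x => ∑ u ∈ nbrs S x, (if δ u < δ x then 1 else ε) * scaledWalks w r ε L S δ u +
      w x.1 * scaledWalks w r ε L (insert s(x, nextVtx S x r) S)
        (Function.update δ (nextVtx S x r) (δ x + 1)) (nextVtx S x r)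

/-- Multiplying by `t` to the power of the depth gives a factor `t` to a step to the parent, `t⁻¹`
to a known child and `w t² t⁻¹ = w t` to a new child. Extracting `t` from every step leaves the
weights `1`, `t⁻²` and `w`. -/
theorem growingWalks_mul_pow_depth {κ w : Bool → ℝ} {t : ℝ} (ht : t ≠ 0)
    (hκ : ∀ b, κ b = w b * t ^ 2) {r : Vtx} (L : ℕ) :
    ∀ (S : Finset (Sym2 Vtx)) (δ : Vtx → ℕ) (x : Vtx), IsTreeDepth S r δ →
      x ∈ insert r (verts S) →
      growingWalks κ L S x r * t ^ δ x = t ^ L * scaledWalks w r (t ^ 2)⁻¹ L S δ x := by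
  induction L with
  | zero =>
    intro S δ x hT _
    simp only [growingWalks, scaledWalks]
    split_ifs with h
    · simp [h, hT.root]
    · simp
  | succ L ih =>
    intro S δ x hT hx
    rw [growingWalks, scaledWalks, add_mul, mul_add, Finset.sum_mul, Finset.mul_sum]
    congr 1
    · refine Finset.sum_congr rfl fun u hu => ?_
      have hu' := mem_nbrs.1 hu
      have h1 := ih S δ u hT (Finset.mem_insert_of_mem (right_mem_verts hu'))
      rcases hT.adj x u hu' with h | h
      · rw [if_neg (by omega)]
        rw [h, pow_succ] at h1
        calc growingWalks κ L S u r * t ^ δ x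
            = growingWalks κ L S u r * (t ^ δ x * t) / t := by field_simp
          _ = t ^ L * scaledWalks w r (t ^ 2)⁻¹ L S δ u / t := by rw [h1]
          _ = _ := by
            generalize scaledWalks w r (t ^ 2)⁻¹ L S δ u = y
            field_simp
            ring
      · rw [if_pos (by omega), h, pow_succ, ← mul_assoc, h1]
        ring
    · have h1 := ih _ _ (nextVtx S x r) (hT.attach hx (isFresh_nextVtx S x r))
        (by simp [verts_insert])
      rw [Function.update_self, pow_succ] at h1
      rw [hκ, pow_succ]
      calc _ = w x.1 * t * (growingWalks κ L (insert s(x, nextVtx S x r) S) (nextVtx S x r) r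
              * (t ^ δ x * t)) := by ring
        _ = _ := by rw [h1]; ring_nf

/-- The walks at depth `h`, at a vertex of type `b`, in which every child is new. -/
def treeWalks (w : Bool → ℝ) : ℕ → Bool → ℕ → ℝ
  | 0, _, h => if h = 0 then 1 else 0
  | L + 1, b, 0 => w b * treeWalks w L (!b) 1
  | L + 1, b, h + 1 => treeWalks w L (!b) h + w b * treeWalks w L (!b) (h + 2)

/-- The walks at depth `h`, at a vertex of type `b`, with exactly one step to a known child, when no
child of the vertices on the path to the root is known at the start. -/
def onceRepeatedWalks (w : Bool → ℝ) : ℕ → Bool → ℕ → ℝ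
  | 0, _, _ => 0
  | L + 1, b, 0 => w b * (onceRepeatedWalks w L (!b) 1 + treeWalks w L (!b) 3)
  | L + 1, b, h + 1 => onceRepeatedWalks w L (!b) h +
      w b * (onceRepeatedWalks w L (!b) (h + 2) + treeWalks w L (!b) (h + 4))

/-- `d` is the number of children of the vertices on the path from `x` to the root. -/
inductive PathDegree (S : Finset (Sym2 Vtx)) (δ : Vtx → ℕ) : Vtx → ℕ → Prop
  | root {x : Vtx} : δ x = 0 → PathDegree S δ x (children S δ x).card
  | step {x v : Vtx} {d : ℕ} : s(x, v) ∈ S → δ v < δ x → PathDegree S δ v d →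
      PathDegree S δ x (d + (children S δ x).card)

theorem children_attach_of_ne {S : Finset (Sym2 Vtx)} {δ : Vtx → ℕ} {x u v : Vtx} {h : ℕ}
    (hu : u ∉ verts S) (hvu : v ≠ u) (hvx : v ≠ x) :
    children (insert s(x, u) S) (Function.update δ u h) v = children S δ v := by
  ext a
  simp only [children, Finset.mem_filter, mem_nbrs, Function.update_of_ne hvu]
  rcases eq_or_ne a u with rfl | hau
  · have h1 : s(v, a) ∉ insert s(x, a) S := by
      rw [Finset.mem_insert, not_or]
      refine ⟨fun h => ?_, fun h => hu (right_mem_verts h)⟩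
      exact hvx (Sym2.congr_left.1 h)
    have h2 : s(v, a) ∉ S := fun h => hu (right_mem_verts h)
    simp [h1, h2]
  · rw [mem_insert_edge_iff_of_ne hvu hau, Function.update_of_ne hau]

theorem card_children_attach_self {S : Finset (Sym2 Vtx)} {δ : Vtx → ℕ} {x u : Vtx}
    (hu : u ∉ verts S) (hux : u ≠ x) :
    (children (insert s(x, u) S) (Function.update δ u (δ x + 1)) x).card
      = (children S δ x).card + 1 := by
  have h1 : u ∉ children S δ x := fun h => hu (mem_verts_of_mem_children h)
  rw [← Finset.card_insert_of_notMem h1]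
  congr 1
  ext a
  simp only [children, Finset.mem_filter, mem_nbrs, Function.update_of_ne hux.symm,
    Finset.mem_insert]
  rcases eq_or_ne a u with rfl | hau
  · simp
  · rw [← Finset.mem_insert, mem_insert_edge_iff_of_ne hux.symm hau, Function.update_of_ne hau]
    simp [hau]

theorem children_attach_new {S : Finset (Sym2 Vtx)} {δ : Vtx → ℕ} {x u : Vtx}
    (hu : u ∉ verts S) (hux : u ≠ x) :
    children (insert s(x, u) S) (Function.update δ u (δ x + 1)) u = ∅ := by
  ext a
  simp only [children, Finset.mem_filter, mem_nbrs, mem_insert_edge_new_iff hu hux,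
    Function.update_self, Finset.notMem_empty, iff_false, not_and, not_not]
  rintro rfl
  rw [Function.update_of_ne hux.symm]
  omega

/-- The path from `v` to the root has depth below that of `x`, so it avoids `x`, the only old vertex
whose children change. -/
theorem PathDegree.attach_of_lt {S : Finset (Sym2 Vtx)} {δ : Vtx → ℕ} {x u v : Vtx} {d : ℕ}
    (hu : u ∉ verts S) (h : PathDegree S δ v d) (hv : v ∈ verts S) (hlt : δ v < δ x) :
    PathDegree (insert s(x, u) S) (Function.update δ u (δ x + 1)) v d := by
  induction h with
  | @root v h0 =>
    have hvu : v ≠ u := fun h => hu (h ▸ hv)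
    have hvx : v ≠ x := by rintro rfl; omega
    rw [← children_attach_of_ne (h := δ x + 1) hu hvu hvx]
    exact .root (by rwa [Function.update_of_ne hvu])
  | @step v v' d hvv hlt' h ih =>
    have hvu : v ≠ u := fun h => hu (h ▸ hv)
    have hvx : v ≠ x := by rintro rfl; omega
    have hv' := right_mem_verts hvv
    have hvu' : v' ≠ u := fun h => hu (h ▸ hv')
    rw [← children_attach_of_ne (h := δ x + 1) hu hvu hvx]
    exact .step (Finset.mem_insert_of_mem hvv)
      (by rwa [Function.update_of_ne hvu, Function.update_of_ne hvu']) (ih hv' (by omega))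

/-- The new leaf has no children and is itself one more child of `x`. -/
theorem PathDegree.attach {S : Finset (Sym2 Vtx)} {δ : Vtx → ℕ} {x u : Vtx} {d : ℕ}
    (hu : u ∉ verts S) (hux : u ≠ x) (h : PathDegree S δ x d) :
    PathDegree (insert s(x, u) S) (Function.update δ u (δ x + 1)) u (d + 1) := by
  have hx : PathDegree (insert s(x, u) S) (Function.update δ u (δ x + 1)) x (d + 1) := by
    cases h with
    | root h0 =>
      rw [← card_children_attach_self hu hux]
      exact .root (by rwa [Function.update_of_ne hux.symm])
    | @step _ v d hv hlt h =>
      have hvS := right_mem_verts hv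
      have hvu : v ≠ u := fun h => hu (h ▸ hvS)
      rw [add_assoc, ← card_children_attach_self hu hux]
      exact .step (Finset.mem_insert_of_mem hv)
        (by rwa [Function.update_of_ne hvu, Function.update_of_ne hux.symm])
        (h.attach_of_lt hu hvS hlt)
  have := PathDegree.step ((mem_insert_edge_new_iff hu hux).2 rfl)
    (by rw [Function.update_self, Function.update_of_ne hux.symm]; omega) hx
  rwa [children_attach_new hu hux, Finset.card_empty, add_zero] at this

/-- One step of `scaledWalks` at the root. -/
theorem IsTreeDepth.scaledWalks_succ_root {w : Bool → ℝ} {S : Finset (Sym2 Vtx)} {r : Vtx}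
    {δ : Vtx → ℕ} (hT : IsTreeDepth S r δ) {x : Vtx} (hx : δ x = 0) (ε : ℝ) (L : ℕ) :
    scaledWalks w r ε (L + 1) S δ x = ε * ∑ u ∈ children S δ x, scaledWalks w r ε L S δ u +
      w x.1 * scaledWalks w r ε L (insert s(x, nextVtx S x r) S)
        (Function.update δ (nextVtx S x r) (δ x + 1)) (nextVtx S x r) := by
  rw [scaledWalks, hT.sum_nbrs_root hx, Finset.mul_sum]
  congr 1
  refine Finset.sum_congr rfl fun u hu => ?_
  rw [if_neg (Finset.mem_filter.1 hu).2]

/-- One step of `scaledWalks` away from the root. -/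
theorem IsTreeDepth.scaledWalks_succ_of_parent {w : Bool → ℝ} {S : Finset (Sym2 Vtx)} {r : Vtx}
    {δ : Vtx → ℕ} (hT : IsTreeDepth S r δ) {x v : Vtx} (hv : s(x, v) ∈ S) (hlt : δ v < δ x)
    (ε : ℝ) (L : ℕ) :
    scaledWalks w r ε (L + 1) S δ x = scaledWalks w r ε L S δ v
      + ε * ∑ u ∈ children S δ x, scaledWalks w r ε L S δ u +
      w x.1 * scaledWalks w r ε L (insert s(x, nextVtx S x r) S)
        (Function.update δ (nextVtx S x r) (δ x + 1)) (nextVtx S x r) := by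
  rw [scaledWalks, hT.sum_nbrs_of_parent hv hlt, if_pos hlt, one_mul, Finset.mul_sum]
  congr 2
  refine Finset.sum_congr rfl fun u hu => ?_
  rw [if_neg (Finset.mem_filter.1 hu).2]

theorem IsTreeDepth.root_or_parent {S : Finset (Sym2 Vtx)} {r : Vtx} {δ : Vtx → ℕ}
    (hT : IsTreeDepth S r δ) {x : Vtx} (hx : x ∈ insert r (verts S)) :
    δ x = 0 ∨ ∃ v, s(x, v) ∈ S ∧ δ v < δ x ∧ δ x = δ v + 1 := by
  by_cases h0 : δ x = 0
  · exact Or.inl h0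
  · have hxS : x ∈ verts S := by
      rcases Finset.mem_insert.1 hx with rfl | h1
      · exact absurd hT.root h0
      · exact h1
    obtain ⟨v, hv, hlt⟩ := hT.parent_exists x hxS h0
    exact Or.inr ⟨v, hv, hlt, by rcases hT.adj x v hv with h1 | h1 <;> omega⟩

/-- The leading order of `scaledWalks`. -/
theorem scaledWalks_zero (w : Bool → ℝ) {r : Vtx} (L : ℕ) :
    ∀ (S : Finset (Sym2 Vtx)) (δ : Vtx → ℕ) (x : Vtx), IsTreeDepth S r δ →
      x ∈ insert r (verts S) → scaledWalks w r 0 L S δ x = treeWalks w L x.1 (δ x) := by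
  induction L with
  | zero =>
    intro S δ x hT hx
    simp only [scaledWalks, treeWalks]
    have : x = r ↔ δ x = 0 := by
      constructor
      · rintro rfl; exact hT.root
      · intro h0
        rcases Finset.mem_insert.1 hx with h1 | h1
        · exact h1
        · exact hT.eq_root x h1 h0
    simp only [this]
  | succ L ih =>
    intro S δ x hT hx
    have hf := isFresh_nextVtx S x r
    have hnew := ih _ _ (nextVtx S x r) (hT.attach hx hf) (by simp [verts_insert])
    rw [Function.update_self, hf.type_eq] at hnew
    rcases IsTreeDepth.root_or_parent hT hx with h0 | ⟨v, hv, hlt, hδ⟩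
    · rw [hT.scaledWalks_succ_root h0, hnew, h0, treeWalks]
      ring
    · rw [hT.scaledWalks_succ_of_parent hv hlt, hnew, hδ, treeWalks,
        ih S δ v hT (Finset.mem_insert_of_mem (right_mem_verts hv)), hT.type_eq x v hv]
      ring

/-- The first order of `scaledWalks`. -/
theorem hasDerivAt_scaledWalks (w : Bool → ℝ) {r : Vtx} (L : ℕ) :
    ∀ (S : Finset (Sym2 Vtx)) (δ : Vtx → ℕ) (x : Vtx) (d : ℕ), IsTreeDepth S r δ →
      x ∈ insert r (verts S) → PathDegree S δ x d →
      HasDerivAt (fun ε => scaledWalks w r ε L S δ x)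
        (onceRepeatedWalks w L x.1 (δ x) + d * treeWalks w L x.1 (δ x + 2)) 0 := by
  -- Each of the `d` children known at the start contributes `treeWalks` at depth `δ x + 2`. Raise
  -- by two the part of the walk before the repeated step: a step from depth `a` to a known child at
  -- `a + 1` becomes the first passage from `a + 2` to `a + 1`, with the same types and weights.
  have hdiff : ∀ (L : ℕ) (S : Finset (Sym2 Vtx)) (δ : Vtx → ℕ) (x : Vtx),
      Differentiable ℝ fun ε => scaledWalks w r ε L S δ x := by
    intro L
    induction L with
    | zero => intro S δ x; simp only [scaledWalks]; fun_prop
    | succ L ih =>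
      intro S δ x
      simp only [scaledWalks]
      refine Differentiable.add (Differentiable.fun_sum fun u _ => ?_) ((ih _ _ _).const_mul _)
      split_ifs
      · exact (ih S δ u).const_mul _
      · exact differentiable_id.mul (ih S δ u)
  induction L with
  | zero =>
    intro S δ x d _ _ _
    simp only [scaledWalks, onceRepeatedWalks, treeWalks]
    exact (hasDerivAt_const (0 : ℝ) (if x = r then (1 : ℝ) else 0)).congr_deriv (by simp)
  | succ L ih =>
    intro S δ x d hT hx hd
    have hf := isFresh_nextVtx S x r
    -- The path degree rises to `d + 1` at the new vertex; the extra `1` is the `treeWalks` term in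
    -- the recursion of `onceRepeatedWalks`.
    have hnew := ih _ _ (nextVtx S x r) _ (hT.attach hx hf) (by simp [verts_insert])
      (hd.attach hf.notMem hf.ne)
    rw [Function.update_self, hf.type_eq] at hnew
    have hchild : HasDerivAt (fun ε => ε * ∑ u ∈ children S δ x, scaledWalks w r ε L S δ u)
        ((children S δ x).card * treeWalks w L (!x.1) (δ x + 1)) 0 := by
      have h1 : Differentiable ℝ fun ε => ∑ u ∈ children S δ x, scaledWalks w r ε L S δ u :=
        Differentiable.fun_sum fun u _ => hdiff L S δ u
      have h2 := (hasDerivAt_id (0 : ℝ)).mul (h1 0).hasDerivAt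
      have h3 : ∑ u ∈ children S δ x, scaledWalks w r 0 L S δ u
          = (children S δ x).card * treeWalks w L (!x.1) (δ x + 1) := by
        rw [Finset.sum_congr rfl (g := fun _ => treeWalks w L (!x.1) (δ x + 1)),
          Finset.sum_const, nsmul_eq_mul]
        intro u hu
        rw [scaledWalks_zero w L S δ u hT
          (Finset.mem_insert_of_mem (mem_verts_of_mem_children hu)),
          hT.depth_of_mem_children hu, hT.type_eq x u (mem_nbrs.1 (Finset.mem_filter.1 hu).1)]
      simp only [id, zero_mul, add_zero, one_mul, h3] at h2
      exact h2
    cases hd with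
    | root h0 =>
      refine ((hchild.add (hnew.const_mul (w x.1))).congr_of_eventuallyEq
        (Eventually.of_forall fun ε => hT.scaledWalks_succ_root h0 ε L)).congr_deriv ?_
      rw [h0]
      simp only [onceRepeatedWalks, treeWalks]
      push_cast
      ring
    | @step _ v d hv hlt hd =>
      have hδ : δ x = δ v + 1 := by rcases hT.adj x v hv with h1 | h1 <;> omega
      have hpar := ih S δ v d hT (Finset.mem_insert_of_mem (right_mem_verts hv)) hd
      refine (((hpar.add hchild).add (hnew.const_mul (w x.1))).congr_of_eventuallyEq
        (Eventually.of_forall fun ε => hT.scaledWalks_succ_of_parent hv hlt ε L)).congr_deriv ?_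
      rw [hδ, hT.type_eq x v hv]
      simp only [onceRepeatedWalks, treeWalks]
      push_cast
      ring

/-! ### Closed forms -/

/-- The coefficient of `sʲ` in `((1 + s)(1 + α / s))ᵏ`. -/
noncomputable def mpCoeff (α : ℝ) : ℕ → ℤ → ℝ
  | 0, j => if j = 0 then 1 else 0
  | k + 1, j => mpCoeff α k (j - 1) + (1 + α) * mpCoeff α k j + α * mpCoeff α k (j + 1)

/-- The substitution `s ↦ α / s` exchanges the two factors of `(1 + s)(1 + α / s)`. -/
theorem mpCoeff_neg (α : ℝ) (k : ℕ) (j : ℕ) :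
    mpCoeff α k (-(j : ℤ)) = α ^ j * mpCoeff α k j := by
  induction k generalizing j with
  | zero =>
    rcases j with _ | j
    · simp
    · have h1 : ¬ (-((j + 1 : ℕ) : ℤ) = 0) := by omega
      have h2 : ¬ (((j + 1 : ℕ) : ℤ) = 0) := by omega
      simp only [mpCoeff, if_neg h1, if_neg h2, mul_zero]
  | succ k ih =>
    rcases j with _ | j
    · simp
    · have h1 := ih (j + 2)
      have h2 := ih (j + 1)
      have h3 := ih j
      simp only [mpCoeff]
      rw [show -((j + 1 : ℕ) : ℤ) - 1 = -((j + 2 : ℕ) : ℤ) by push_cast; ring,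
        show -((j + 1 : ℕ) : ℤ) + 1 = -(j : ℤ) by push_cast; ring, h1, h2, h3,
        show ((j + 1 : ℕ) : ℤ) - 1 = (j : ℤ) by push_cast; ring,
        show ((j + 1 : ℕ) : ℤ) + 1 = ((j + 2 : ℕ) : ℤ) by push_cast; ring]
      ring

/-- The weights of new children in the rescaled tree: `α` at rows and `1` at columns. -/
def mpWeight (α : ℝ) : Bool → ℝ
  | false => α
  | true => 1

theorem treeWalks_add_two_root (α : ℝ) (L : ℕ) :
    treeWalks (mpWeight α) (L + 2) false 0
      = α * (treeWalks (mpWeight α) L false 0 + treeWalks (mpWeight α) L false 2) := by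
  simp [treeWalks, mpWeight]

theorem treeWalks_add_two (α : ℝ) (L h : ℕ) :
    treeWalks (mpWeight α) (L + 2) false (h + 2)
      = treeWalks (mpWeight α) L false h + (1 + α) * treeWalks (mpWeight α) L false (h + 2)
        + α * treeWalks (mpWeight α) L false (h + 4) := by
  simp [treeWalks, mpWeight]
  ring

/-- Method of images: the right-hand side is the coefficient of `sʲ` in `(1 + α/s)(s - α/s)Fᵏ` with
`F = (1 + s)(1 + α/s)`. It satisfies the interior recursion for every integer `j`, and by
`mpCoeff_neg` its values at `-1` and `0` are opposite, which turns the interior recursion at `0`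
into the one at the root. -/
theorem treeWalks_even (α : ℝ) (k j : ℕ) :
    treeWalks (mpWeight α) (2 * k + 2) false (2 * j)
      = mpCoeff α k (j - 1) + α * mpCoeff α k j - α * mpCoeff α k (j + 1)
        - α ^ 2 * mpCoeff α k (j + 2) := by
  induction k generalizing j with
  | zero =>
    rcases j with _ | _ | j
    · simp [treeWalks, mpWeight, mpCoeff]
    · simp [treeWalks, mpWeight, mpCoeff]
    · have h1 : ¬ ((j : ℤ) + 1 = 0) := by omega
      have h2 : ¬ ((j : ℤ) + 1 + 1 = 0) := by omega
      have h3 : ¬ ((j : ℤ) + 1 + 1 + 1 = 0) := by omega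
      have h4 : ¬ ((j : ℤ) + 1 + 1 + 2 = 0) := by omega
      simp [treeWalks, mpWeight, mpCoeff, h1, h2, h3, h4, Nat.mul_add]
  | succ k ih =>
    rcases j with _ | j
    · have h0 := ih 0
      have h1 := ih 1
      have s1 := mpCoeff_neg α k 1
      have s2 := mpCoeff_neg α k 2
      rw [show 2 * (k + 1) + 2 = (2 * k + 2) + 2 by ring, mul_zero, treeWalks_add_two_root]
      simp only [mul_zero, mul_one, Nat.cast_zero, Nat.cast_one, Nat.cast_ofNat, mpCoeff] at *
      norm_num at *
      rw [h0, h1, s1, s2]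
      ring
    · have h0 := ih j
      have h1 := ih (j + 1)
      have h2 := ih (j + 2)
      rw [show 2 * (k + 1) + 2 = (2 * k + 2) + 2 by ring, show 2 * (j + 1) = 2 * j + 2 by ring,
        treeWalks_add_two, h0, show 2 * j + 2 = 2 * (j + 1) by ring, h1,
        show 2 * j + 4 = 2 * (j + 2) by ring, h2]
      simp only [mpCoeff]
      push_cast
      ring_nf

theorem onceRepeatedWalks_add_two_root (α : ℝ) (L : ℕ) :
    onceRepeatedWalks (mpWeight α) (L + 2) false 0
      = α * (onceRepeatedWalks (mpWeight α) L false 0 + onceRepeatedWalks (mpWeight α) L false 2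
        + treeWalks (mpWeight α) L false 2 + 2 * treeWalks (mpWeight α) L false 4) := by
  simp only [onceRepeatedWalks, treeWalks, mpWeight, Bool.not_false, Bool.not_true]
  ring

theorem onceRepeatedWalks_add_two (α : ℝ) (L h : ℕ) :
    onceRepeatedWalks (mpWeight α) (L + 2) false (h + 2)
      = onceRepeatedWalks (mpWeight α) L false h
        + onceRepeatedWalks (mpWeight α) L false (h + 2) + treeWalks (mpWeight α) L false (h + 4)
        + α * (onceRepeatedWalks (mpWeight α) L false (h + 2)
          + onceRepeatedWalks (mpWeight α) L false (h + 4)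
          + treeWalks (mpWeight α) L false (h + 4) + 2 * treeWalks (mpWeight α) L false (h + 6)) := by
  simp only [onceRepeatedWalks, treeWalks, mpWeight, Bool.not_false, Bool.not_true]
  ring

/-- Only `j = 0` is needed for the expansion, where `α [s²]Fᵏ⁺¹` remains, but the recursion couples
all depths. The terms linear in `j` absorb the `treeWalks` sources in that recursion. -/
theorem onceRepeatedWalks_even (α : ℝ) (k j : ℕ) :
    onceRepeatedWalks (mpWeight α) (2 * k + 2) false (2 * j)
      = (j + 1) * α * mpCoeff α (k + 1) (j + 2)
        + j * (mpCoeff α k (j + 1) + 2 * α * mpCoeff α k (j + 2) + α ^ 2 * mpCoeff α k (j + 3)) := by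
  induction k generalizing j with
  | zero =>
    have h2 : ∀ i : ℕ, 0 < i → ¬ ((j : ℤ) + i = 0) := by intro i hi; omega
    have h1 := h2 1 (by norm_num)
    have h3 := h2 3 (by norm_num)
    have h4 := h2 2 (by norm_num)
    have h5 : ¬ ((j : ℤ) + 2 - 1 = 0) := by omega
    have h6 : ¬ ((j : ℤ) + 2 + 1 = 0) := by omega
    push_cast at h1 h3 h4
    simp only [mpCoeff, if_neg h1, if_neg h3, if_neg h4, if_neg h5, if_neg h6, mul_zero, add_zero]
    rcases j with _ | j
    · simp [onceRepeatedWalks, treeWalks]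
    · simp [onceRepeatedWalks, treeWalks, Nat.mul_add]
  | succ k ih =>
    rcases j with _ | j
    · have h0 := ih 0
      have h1 := ih 1
      have t1 := treeWalks_even α k 1
      have t2 := treeWalks_even α k 2
      rw [show 2 * (k + 1) + 2 = (2 * k + 2) + 2 by ring, mul_zero,
        onceRepeatedWalks_add_two_root]
      simp only [mul_zero, mul_one, Nat.cast_zero, Nat.cast_one, Nat.cast_ofNat, mpCoeff] at *
      norm_num [-mul_eq_mul_left_iff] at *
      rw [h0, h1, t1, t2]
      ring
    · have h0 := ih j
      have h1 := ih (j + 1)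
      have h2 := ih (j + 2)
      have t2 := treeWalks_even α k (j + 2)
      have t3 := treeWalks_even α k (j + 3)
      rw [show 2 * (k + 1) + 2 = (2 * k + 2) + 2 by ring, show 2 * (j + 1) = 2 * j + 2 by ring,
        onceRepeatedWalks_add_two, h0, show 2 * j + 2 = 2 * (j + 1) by ring, h1,
        show 2 * j + 4 = 2 * (j + 2) by ring, h2, t2, show 2 * j + 6 = 2 * (j + 3) by ring, t3]
      simp only [mpCoeff]
      push_cast
      ring_nf

/-! ### Expansion of the moments -/

/-- With `t = √c`, the factor `t ^ (2k) = cᵏ` cancels the normalization of the Wishart matrix. -/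
theorem limitMoment_eq_scaledWalks {α c : ℝ} (hc : 0 < c) (k : ℕ) :
    limitMoment α c k
      = scaledWalks (mpWeight α) (false, 0) c⁻¹ (2 * k) ∅ (fun _ => 0) (false, 0) := by
  have h := growingWalks_mul_pow_depth (κ := branching α c) (w := mpWeight α)
    (Real.sqrt_pos.2 hc).ne' (by
      rintro (_ | _) <;> simp [branching, mpWeight, Real.sq_sqrt hc.le])
    (2 * k) ∅ _ (false, 0) (isTreeDepth_empty (false, 0)) (by simp)
  rw [pow_zero, mul_one, pow_mul, Real.sq_sqrt hc.le] at h
  rw [limitMoment, h, ← mul_assoc, ← mul_pow, inv_mul_cancel₀ hc.ne', one_pow, one_mul]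

/-- The first-order expansion of the moments of the limiting spectral law. -/
theorem limitMoment_isLittleO (α : ℝ) (k : ℕ) :
    (fun c : ℝ => limitMoment α c (k + 1)
      - (α * (mpCoeff α k 0 - α * mpCoeff α k 2) + c⁻¹ * (α * mpCoeff α (k + 1) 2)))
      =o[atTop] fun c : ℝ => 1 / c := by
  have hd := hasDerivAt_scaledWalks (mpWeight α) (2 * (k + 1)) ∅ _ (false, 0) _
    (isTreeDepth_empty (false, 0)) (by simp) (.root rfl)
  have hz := scaledWalks_zero (mpWeight α) (2 * (k + 1)) ∅ _ (false, 0)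
    (isTreeDepth_empty (false, 0)) (by simp)
  have hcard : (children ∅ (fun _ => 0) (false, 0)).card = 0 := by
    rw [Finset.card_eq_zero]
    rfl
  have ht := treeWalks_even α k 0
  have ho := onceRepeatedWalks_even α k 0
  have s1 := mpCoeff_neg α k 1
  rw [hcard, Nat.cast_zero, zero_mul, add_zero] at hd
  rw [hasDerivAt_iff_isLittleO] at hd
  -- The expansion at `ε = 0` is read along `ε = c⁻¹`.
  have hlim := hd.comp_tendsto tendsto_inv_atTop_zero
  refine (hlim.congr' ?_ ?_)
  · filter_upwards [eventually_gt_atTop 0] with c hc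
    rw [limitMoment_eq_scaledWalks hc]
    simp only [Function.comp_apply, hz, sub_zero, smul_eq_mul]
    rw [show 2 * (k + 1) = 2 * k + 2 by ring]
    simp only [mul_zero, Nat.cast_zero, Nat.cast_one, pow_one] at ht ho s1
    norm_num at ht ho s1
    rw [ht, ho, s1]
    ring
  · exact Eventually.of_forall fun c => by simp

/-! ### Moments of the Marchenko-Pastur law and of its perturbation -/

/-- The parametrization `1 + α + 2√α cos θ` of the Marchenko-Pastur bulk. -/
noncomputable def mpParam (α θ : ℝ) : ℝ := 1 + α + 2 * √α * Real.cos θ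

theorem continuous_mpParam (α : ℝ) : Continuous (mpParam α) := by
  unfold mpParam
  fun_prop

theorem hasDerivAt_mpParam (α θ : ℝ) :
    HasDerivAt (mpParam α) (-(2 * √α * Real.sin θ)) θ := by
  have h := ((Real.hasDerivAt_cos θ).const_mul (2 * √α)).const_add (1 + α)
  exact h.congr_deriv (by ring)

theorem injOn_mpParam {α : ℝ} (hα : 0 < α) : InjOn (mpParam α) (Ioo 0 Real.pi) := by
  intro x hx y hy h
  have hs : (2 * √α) ≠ 0 := by positivity
  exact Real.injOn_cos (Ioo_subset_Icc_self hx) (Ioo_subset_Icc_self hy)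
    (mul_left_cancel₀ hs (add_left_cancel h))

theorem mpLeft_eq {α : ℝ} (hα : 0 < α) : mpLeft α = 1 + α - 2 * √α := by
  have := Real.sq_sqrt hα.le
  rw [mpLeft]
  linear_combination this

theorem mpRight_eq {α : ℝ} (hα : 0 < α) : mpRight α = 1 + α + 2 * √α := by
  have := Real.sq_sqrt hα.le
  rw [mpRight]
  linear_combination this

theorem image_mpParam {α : ℝ} (hα : 0 < α) :
    mpParam α '' Ioo 0 Real.pi = Ioo (mpLeft α) (mpRight α) := by
  have hs : 0 < √α := Real.sqrt_pos.2 hα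
  rw [mpLeft_eq hα, mpRight_eq hα]
  ext x
  constructor
  · rintro ⟨θ, hθ, rfl⟩
    have h0 : 0 < Real.sin θ := Real.sin_pos_of_pos_of_lt_pi hθ.1 hθ.2
    have h1 := Real.sin_sq_add_cos_sq θ
    have h2 : Real.cos θ < 1 := by nlinarith
    have h3 : -1 < Real.cos θ := by nlinarith
    constructor <;> unfold mpParam <;> nlinarith
  · rintro ⟨h1, h2⟩
    have h3 : -1 < (x - (1 + α)) / (2 * √α) := by
      rw [lt_div_iff₀ (by positivity)]
      linarith
    have h4 : (x - (1 + α)) / (2 * √α) < 1 := by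
      rw [div_lt_iff₀ (by positivity)]
      linarith
    refine ⟨Real.arccos ((x - (1 + α)) / (2 * √α)), ⟨Real.arccos_pos.2 h4, ?_⟩, ?_⟩
    · refine lt_of_le_of_ne (Real.arccos_le_pi _) fun h => ?_
      exact absurd (Real.arccos_eq_pi.1 h) (not_le.2 h3)
    · rw [mpParam, Real.cos_arccos h3.le h4.le]
      field_simp
      ring

theorem sqrt_mpParam {α θ : ℝ} (hα : 0 < α) (hθ : θ ∈ Ioo 0 Real.pi) :
    √((mpRight α - mpParam α θ) * (mpParam α θ - mpLeft α)) = 2 * √α * Real.sin θ := by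
  have h0 : 0 < Real.sin θ := Real.sin_pos_of_pos_of_lt_pi hθ.1 hθ.2
  have h1 := Real.sin_sq_add_cos_sq θ
  rw [mpLeft_eq hα, mpRight_eq hα, mpParam,
    show (1 + α + 2 * √α - (1 + α + 2 * √α * Real.cos θ)) *
      (1 + α + 2 * √α * Real.cos θ - (1 + α - 2 * √α)) = (2 * √α * Real.sin θ) ^ 2 by
      linear_combination (-4 * √α ^ 2) * h1]
  exact Real.sqrt_sq (by positivity)

theorem integrableOn_bulk_iff {α : ℝ} (hα : 0 < α) (g : ℝ → ℝ) :
    IntegrableOn g (Ioo (mpLeft α) (mpRight α)) ↔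
      IntegrableOn (fun θ => 2 * √α * Real.sin θ * g (mpParam α θ)) (Ioo 0 Real.pi) := by
  rw [← image_mpParam hα, integrableOn_image_iff_integrableOn_abs_deriv_smul measurableSet_Ioo
    (fun θ _ => (hasDerivAt_mpParam α θ).hasDerivWithinAt) (injOn_mpParam hα)]
  refine integrableOn_congr_fun (fun θ hθ => ?_) measurableSet_Ioo
  have h0 : 0 < Real.sin θ := Real.sin_pos_of_pos_of_lt_pi hθ.1 hθ.2
  simp only [smul_eq_mul]
  rw [abs_neg, abs_of_nonneg (by positivity)]

theorem integral_bulk {α : ℝ} (hα : 0 < α) (g : ℝ → ℝ) :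
    ∫ x in Ioo (mpLeft α) (mpRight α), g x =
      ∫ θ in Ioo 0 Real.pi, 2 * √α * Real.sin θ * g (mpParam α θ) := by
  rw [← image_mpParam hα, integral_image_eq_integral_abs_deriv_smul measurableSet_Ioo
    (fun θ _ => (hasDerivAt_mpParam α θ).hasDerivWithinAt) (injOn_mpParam hα)]
  refine setIntegral_congr_fun measurableSet_Ioo fun θ hθ => ?_
  have h0 : 0 < Real.sin θ := Real.sin_pos_of_pos_of_lt_pi hθ.1 hθ.2
  simp only [smul_eq_mul]
  rw [abs_neg, abs_of_nonneg (by positivity)]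

theorem integrableOn_Ioo_of_continuous {f : ℝ → ℝ} (hf : Continuous f) (a b : ℝ) :
    IntegrableOn f (Ioo a b) :=
  (hf.continuousOn.integrableOn_Icc (a := a) (b := b)).mono_set Ioo_subset_Icc_self

theorem integral_cos_int_mul (j : ℤ) :
    ∫ θ in Ioo 0 Real.pi, Real.cos (j * θ) = if j = 0 then Real.pi else 0 := by
  rw [← integral_Ioc_eq_integral_Ioo, ← intervalIntegral.integral_of_le Real.pi_pos.le]
  split_ifs with h
  · simp [h]
  · rw [intervalIntegral.integral_comp_mul_left (fun x => Real.cos x) (Int.cast_ne_zero.2 h)]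
    simp [Real.sin_int_mul_pi]

/-- The cosine coefficients of `θ ↦ mpParam α θ ^ k`. -/
theorem integral_mpParam_pow_mul_cos {α : ℝ} (hα : 0 < α) (k : ℕ) (j : ℤ) :
    ∫ θ in Ioo 0 Real.pi, mpParam α θ ^ k * Real.cos (j * θ)
      = Real.pi * (√α ^ j * mpCoeff α k j) := by
  have hs : √α ≠ 0 := (Real.sqrt_pos.2 hα).ne'
  have hc := continuous_mpParam α
  induction k generalizing j with
  | zero =>
    simp only [pow_zero, one_mul, mpCoeff]
    rw [integral_cos_int_mul]
    split_ifs with h <;> simp [h]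
  | succ k ih =>
    have hI : ∀ i : ℤ, IntegrableOn (fun θ => mpParam α θ ^ k * Real.cos (i * θ))
        (Ioo 0 Real.pi) := fun i => integrableOn_Ioo_of_continuous (by fun_prop) _ _
    -- The identity `2 cos θ cos jθ = cos (j+1)θ + cos (j-1)θ` reproduces the recursion of
    -- `mpCoeff`; the factor `√αʲ` makes the two outer coefficients of that recursion equal.
    have hrec : ∀ θ, mpParam α θ ^ (k + 1) * Real.cos (j * θ)
        = (1 + α) * (mpParam α θ ^ k * Real.cos (j * θ))
          + √α * (mpParam α θ ^ k * Real.cos ((j + 1 : ℤ) * θ)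
            + mpParam α θ ^ k * Real.cos ((j - 1 : ℤ) * θ)) := by
      intro θ
      push_cast
      rw [pow_succ, add_mul (j : ℝ), sub_mul, one_mul, Real.cos_add, Real.cos_sub]
      nth_rewrite 2 [mpParam]
      ring
    simp only [hrec]
    rw [integral_add ((hI j).const_mul _) (((hI (j + 1)).fun_add (hI (j - 1))).const_mul _),
      integral_const_mul, integral_const_mul, integral_add (hI _) (hI _), ih, ih, ih, mpCoeff,
      zpow_add₀ hs, zpow_sub₀ hs, zpow_one]
    have h2 := Real.sq_sqrt hα.le
    field_simp
    rw [h2]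
    ring

/-- The square root in the denominator is exactly the Jacobian `2√α sin θ`, and the numerator is `(x
- 1 - α)² - 2α = 2α cos 2θ`. -/
theorem mul_perturbationDensity_mpParam {α θ : ℝ} (hα : 0 < α) (hθ : θ ∈ Ioo 0 Real.pi) (k : ℕ) :
    2 * √α * Real.sin θ * (mpParam α θ ^ k *
      ((mpParam α θ ^ 2 - 2 * mpParam α θ * (α + 1) + (α ^ 2 + 1)) /
        (2 * α * Real.pi * √((mpRight α - mpParam α θ) * (mpParam α θ - mpLeft α)))))
      = Real.pi⁻¹ * (mpParam α θ ^ k * Real.cos ((2 : ℤ) * θ)) := by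
  have h0 : 0 < Real.sin θ := Real.sin_pos_of_pos_of_lt_pi hθ.1 hθ.2
  have hs : 0 < √α := Real.sqrt_pos.2 hα
  have h2 := Real.sq_sqrt hα.le
  have hnum : mpParam α θ ^ 2 - 2 * mpParam α θ * (α + 1) + (α ^ 2 + 1)
      = 2 * α * Real.cos ((2 : ℤ) * θ) := by
    rw [Int.cast_ofNat, Real.cos_two_mul, mpParam]
    linear_combination 4 * Real.cos θ ^ 2 * h2
  rw [sqrt_mpParam hα hθ, hnum]
  field_simp

theorem pow_mul_perturbationDensity (α : ℝ) (k : ℕ) :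
    (fun x => x ^ k * perturbationDensity α x) = (Ioo (mpLeft α) (mpRight α)).indicator fun x =>
      x ^ k * ((x ^ 2 - 2 * x * (α + 1) + (α ^ 2 + 1)) /
        (2 * α * Real.pi * √((mpRight α - x) * (x - mpLeft α)))) := by
  ext x
  rw [perturbationDensity]
  by_cases hx : x ∈ Ioo (mpLeft α) (mpRight α)
  · rw [indicator_of_mem hx, indicator_of_mem hx]
  · rw [indicator_of_notMem hx, indicator_of_notMem hx, mul_zero]

theorem integrable_pow_mul_perturbationDensity {α : ℝ} (hα : 0 < α) (k : ℕ) :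
    Integrable fun x => x ^ k * perturbationDensity α x := by
  rw [pow_mul_perturbationDensity, integrable_indicator_iff measurableSet_Ioo,
    integrableOn_bulk_iff hα, integrableOn_congr_fun
      (fun θ hθ => mul_perturbationDensity_mpParam hα hθ k) measurableSet_Ioo]
  have hc := continuous_mpParam α
  exact integrableOn_Ioo_of_continuous (by fun_prop) _ _

theorem integral_pow_mul_perturbationDensity {α : ℝ} (hα : 0 < α) (k : ℕ) :
    ∫ x, x ^ k * perturbationDensity α x = α * mpCoeff α k 2 := by
  rw [pow_mul_perturbationDensity, integral_indicator measurableSet_Ioo, integral_bulk hα,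
    setIntegral_congr_fun measurableSet_Ioo
      (fun θ hθ => mul_perturbationDensity_mpParam hα hθ k), integral_const_mul,
    integral_mpParam_pow_mul_cos hα, inv_mul_cancel_left₀ Real.pi_ne_zero]
  rw [show √α ^ (2 : ℤ) = √α ^ 2 from zpow_natCast _ 2, Real.sq_sqrt hα.le]

theorem integrable_perturbationDensity {α : ℝ} (hα : 0 < α) :
    Integrable (perturbationDensity α) := by
  simpa using integrable_pow_mul_perturbationDensity hα 0

theorem measurable_perturbationDensity (α : ℝ) : Measurable (perturbationDensity α) := by
  unfold perturbationDensity
  exact Measurable.indicator (by fun_prop) measurableSet_Ioo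

/-- The Jacobian and the square root combine to `4α sin²θ = 2α(1 - cos 2θ)`. One power of `x` is
spent on the `1 / x` of the density, hence the exponent `k + 1`. -/
theorem mul_mpDensity_mpParam {α θ : ℝ} (hα : 0 < α) (hθ : θ ∈ Ioo 0 Real.pi) (k : ℕ) :
    2 * √α * Real.sin θ * (mpDensity α (mpParam α θ) * mpParam α θ ^ (k + 1))
      = Real.pi⁻¹ * α * (mpParam α θ ^ k * Real.cos ((0 : ℤ) * θ)
        - mpParam α θ ^ k * Real.cos ((2 : ℤ) * θ)) := by
  have h2 := Real.sq_sqrt hα.le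
  have h1 := Real.sin_sq_add_cos_sq θ
  have hx : 0 < mpParam α θ := by
    have := image_mpParam hα ▸ mem_image_of_mem (mpParam α) hθ
    exact lt_of_le_of_lt (sq_nonneg _) this.1
  rw [mpDensity, sqrt_mpParam hα hθ, Int.cast_zero, Int.cast_ofNat, Real.cos_two_mul, zero_mul,
    Real.cos_zero]
  field_simp
  rw [h2]
  linear_combination 2 * α * mpParam α θ * mpParam α θ ^ k * h1

theorem mpDensity_nonneg {α x : ℝ} (hx : x ∈ Ioo (mpLeft α) (mpRight α)) :
    0 ≤ mpDensity α x := by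
  have : 0 < x := lt_of_le_of_lt (sq_nonneg _) hx.1
  unfold mpDensity
  positivity

theorem measurable_mpDensity (α : ℝ) : Measurable (mpDensity α) := by
  unfold mpDensity
  fun_prop

theorem integrableOn_mpDensity_mul_pow {α : ℝ} (hα : 0 < α) (k : ℕ) :
    IntegrableOn (fun x => mpDensity α x * x ^ (k + 1)) (Ioo (mpLeft α) (mpRight α)) := by
  rw [integrableOn_bulk_iff hα, integrableOn_congr_fun
      (fun θ hθ => mul_mpDensity_mpParam hα hθ k) measurableSet_Ioo]
  have hc := continuous_mpParam α
  exact integrableOn_Ioo_of_continuous (by fun_prop) _ _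

theorem ofReal_mpDensity_smul_ae_eq (α : ℝ) (k : ℕ) :
    (fun x => (ENNReal.ofReal (mpDensity α x)).toReal • x ^ (k + 1))
      =ᵐ[volume.restrict (Ioo (mpLeft α) (mpRight α))] fun x => mpDensity α x * x ^ (k + 1) := by
  filter_upwards [ae_restrict_mem measurableSet_Ioo] with x hx
  rw [ENNReal.toReal_ofReal (mpDensity_nonneg hx), smul_eq_mul]

theorem integrable_pow_bulk {α : ℝ} (hα : 0 < α) (k : ℕ) :
    Integrable (fun x : ℝ => x ^ (k + 1)) ((volume.restrict (Ioo (mpLeft α) (mpRight α))).withDensity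
      fun x => ENNReal.ofReal (mpDensity α x)) := by
  rw [integrable_withDensity_iff_integrable_smul' (measurable_mpDensity α).ennreal_ofReal
    (ae_of_all _ fun x => ENNReal.ofReal_lt_top), integrable_congr (ofReal_mpDensity_smul_ae_eq α k)]
  exact integrableOn_mpDensity_mul_pow hα k

theorem integrable_pow_dirac (k : ℕ) (C : ℝ) :
    Integrable (fun x : ℝ => x ^ k) (ENNReal.ofReal C • Measure.dirac 0) :=
  (integrable_dirac (by simp)).smul_measure ENNReal.ofReal_ne_top

theorem integrable_pow_marchenkoPastur {α : ℝ} (hα : 0 < α) (k : ℕ) :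
    Integrable (fun x : ℝ => x ^ (k + 1)) (marchenkoPastur α) :=
  (integrable_pow_bulk hα k).add_measure (integrable_pow_dirac _ _)

/-- The atom at `0` does not contribute to a positive power, so the formula is the same for `α < 1`
and `α ≥ 1`. -/
theorem integral_pow_marchenkoPastur {α : ℝ} (hα : 0 < α) (k : ℕ) :
    ∫ x, x ^ (k + 1) ∂(marchenkoPastur α) = α * (mpCoeff α k 0 - α * mpCoeff α k 2) := by
  have hc := continuous_mpParam α
  have hI : ∀ i : ℤ, IntegrableOn (fun θ => mpParam α θ ^ k * Real.cos (i * θ))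
        (Ioo 0 Real.pi) := fun i => integrableOn_Ioo_of_continuous (by fun_prop) _ _
  rw [marchenkoPastur, integral_add_measure (integrable_pow_bulk hα k) (integrable_pow_dirac _ _),
    integral_smul_measure, integral_dirac, zero_pow k.succ_ne_zero, smul_zero, add_zero,
    integral_withDensity_eq_integral_toReal_smul (measurable_mpDensity α).ennreal_ofReal
      (ae_of_all _ fun x => ENNReal.ofReal_lt_top),
    integral_congr_ae (ofReal_mpDensity_smul_ae_eq α k), integral_bulk hα,
    setIntegral_congr_fun measurableSet_Ioo (fun θ hθ => mul_mpDensity_mpParam hα hθ k),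
    integral_const_mul, integral_sub (hI 0) (hI 2), integral_mpParam_pow_mul_cos hα,
    integral_mpParam_pow_mul_cos hα, zpow_zero,
    show √α ^ (2 : ℤ) = √α ^ 2 from zpow_natCast _ 2, Real.sq_sqrt hα.le]
  field_simp

/-! ### Integration against a signed measure with a density -/

section WithDensity

variable {X : Type*} [MeasurableSpace X] {μ : Measure X} {f g : X → ℝ}

theorem integrable_withDensityᵥ (hf : Integrable f μ) (hfm : Measurable f) (hgm : Measurable g)
    (hgf : Integrable (fun x => g x * f x) μ) : (μ.withDensityᵥ f).Integrable g := by
  rw [VectorMeasure.Integrable, Measure.variation_withDensityᵥ hf,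
    integrable_withDensity_iff_integrable_smul' hfm.enorm (ae_of_all _ fun x => enorm_lt_top)]
  refine hgf.mono (hfm.enorm.ennreal_toReal.smul hgm).aestronglyMeasurable
    (ae_of_all _ fun x => ?_)
  rw [toReal_enorm, norm_smul, norm_norm, norm_mul, mul_comm]

theorem integrable_toReal_ofReal_smul (hfm : Measurable f) (hgm : Measurable g)
    (hgf : Integrable (fun x => g x * f x) μ) :
    Integrable (fun x => (ENNReal.ofReal (f x)).toReal • g x) μ := by
  refine hgf.mono (hfm.ennreal_ofReal.ennreal_toReal.smul hgm).aestronglyMeasurable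
    (ae_of_all _ fun x => ?_)
  rw [norm_smul, norm_mul, mul_comm, ENNReal.toReal_ofReal', Real.norm_eq_abs (max _ _),
    abs_of_nonneg (le_max_right _ _)]
  exact mul_le_mul_of_nonneg_left (max_le (le_abs_self _) (abs_nonneg _)) (norm_nonneg _)

/-- The signed measure is the difference of the positive measures with densities `f⁺` and `f⁻`, and
the integral is additive over it because `g f⁺` and `g f⁻` are both dominated by `|g f|`. -/
theorem integral_withDensityᵥ (hf : Integrable f μ) (hfm : Measurable f) (hgm : Measurable g)
    (hgf : Integrable (fun x => g x * f x) μ) :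
    ∫ᵛ x, g x ∂<•(μ.withDensityᵥ f) = ∫ x, g x * f x ∂μ := by
  have hpos := integrable_toReal_ofReal_smul hfm hgm hgf
  have hneg := integrable_toReal_ofReal_smul hfm.neg hgm
    (by simpa using hgf.neg : Integrable (fun x => g x * (-f) x) μ)
  have hfin₁ := isFiniteMeasure_withDensity_ofReal hf.2
  have hfin₂ := isFiniteMeasure_withDensity_ofReal hf.neg.2
  have htop : ∀ h : X → ℝ, ∀ᵐ x ∂μ, ENNReal.ofReal (h x) < ∞ :=
    fun h => ae_of_all _ fun x => ENNReal.ofReal_lt_top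
  rw [withDensityᵥ_eq_withDensity_pos_part_sub_withDensity_neg_part hf,
    VectorMeasure.integral_sub_vectorMeasure, VectorMeasure.integral_toSignedMeasure,
    VectorMeasure.integral_toSignedMeasure,
    integral_withDensity_eq_integral_toReal_smul hfm.ennreal_ofReal (htop f),
    integral_withDensity_eq_integral_toReal_smul (f := fun x => ENNReal.ofReal (-f x))
      hfm.neg.ennreal_ofReal (htop (-f)),
    ← integral_sub hpos (by exact hneg)]
  · refine integral_congr_ae (ae_of_all _ fun x => ?_)
    simp only [ENNReal.toReal_ofReal', smul_eq_mul]
    rw [← sub_mul, max_zero_sub_max_neg_zero_eq_self, mul_comm]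
  · rw [VectorMeasure.Integrable, Measure.variation_toSignedMeasure]
    exact (integrable_withDensity_iff_integrable_smul' hfm.ennreal_ofReal (htop f)).2 hpos
  · rw [VectorMeasure.Integrable, Measure.variation_toSignedMeasure]
    exact (integrable_withDensity_iff_integrable_smul' hfm.neg.ennreal_ofReal (htop (-f))).2 hneg

end WithDensity

/-- The equivalence expresses existence and uniqueness, so the default value in
`limitingSpectralLaw` never occurs for `c > 0`. The integrability clauses ensure that no moment is
the default `0` of a divergent integral. -/
theorem theorem3 (α : ℝ) (hα : 0 < α) :
    (∀ c : ℝ, 0 < c →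
      (∀ μ : Measure ℝ, IsLimitingSpectralLaw α c μ ↔ μ = limitingSpectralLaw α c) ∧
      ∀ k : ℕ, Integrable (fun x : ℝ => x ^ k) (limitingSpectralLaw α c)) ∧
    ∃ μ₁ : SignedMeasure ℝ,
      (∀ k : ℕ, 1 ≤ k →
        (∀ c : ℝ, 0 < c →
          ((marchenkoPastur α).toSignedMeasure + c⁻¹ • μ₁).Integrable (fun x : ℝ => x ^ k)) ∧
        (fun c : ℝ => (∫ x, x ^ k ∂(limitingSpectralLaw α c))
            - signedMoment k ((marchenkoPastur α).toSignedMeasure + c⁻¹ • μ₁))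
          =o[atTop] fun c : ℝ => 1 / c) ∧
      μ₁ univ = 0 ∧
      Integrable (perturbationDensity α) ∧
      μ₁ = volume.withDensityᵥ (perturbationDensity α) := by
  have hp := integrable_perturbationDensity hα
  have hpm := measurable_perturbationDensity α
  refine ⟨fun c hc => ⟨fun μ => ⟨fun h => ?_, fun h => ?_⟩, fun k => ?_⟩,
    volume.withDensityᵥ (perturbationDensity α), fun k hk => ?_, ?_, hp, rfl⟩
  · exact h.unique hα (isLimitingSpectralLaw_limitingSpectralLaw hα hc)
  · exact h ▸ isLimitingSpectralLaw_limitingSpectralLaw hα hc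
  · exact (moment_limitingSpectralLaw hα hc k).1
  · obtain ⟨k, rfl⟩ := Nat.exists_eq_succ_of_ne_zero (Nat.one_le_iff_ne_zero.1 hk)
    have h1 : (marchenkoPastur α).toSignedMeasure.Integrable fun x : ℝ => x ^ (k + 1) := by
      rw [VectorMeasure.Integrable, Measure.variation_toSignedMeasure]
      exact integrable_pow_marchenkoPastur hα k
    have hm : Measurable fun x : ℝ => x ^ (k + 1) := by fun_prop
    have h2 := integrable_withDensityᵥ hp hpm hm (integrable_pow_mul_perturbationDensity hα (k + 1))
    refine ⟨fun c _ => h1.add_vectorMeasure (h2.smul_vectorMeasure _), ?_⟩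
    refine (limitMoment_isLittleO α k).congr' ?_ EventuallyEq.rfl
    filter_upwards [eventually_gt_atTop 0] with c hc
    rw [(moment_limitingSpectralLaw hα hc (k + 1)).2, signedMoment,
      VectorMeasure.integral_add_vectorMeasure h1 (h2.smul_vectorMeasure _),
      VectorMeasure.integral_smul_vectorMeasure, VectorMeasure.integral_toSignedMeasure,
      integral_pow_marchenkoPastur hα, integral_withDensityᵥ hp hpm
        hm (integrable_pow_mul_perturbationDensity hα (k + 1)),
      integral_pow_mul_perturbationDensity hα, smul_eq_mul]
  · rw [withDensityᵥ_apply hp MeasurableSet.univ, setIntegral_univ]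
    -- The total mass is the moment of order `0`, which is `α [s²]F⁰ = 0`.
    have h := integral_pow_mul_perturbationDensity hα 0
    simpa [mpCoeff] using h
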